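/- Conventions. ``Definable'' means definable by a first-order formula, with parameters allowed. Let $\langle R;+,<\rangle$ be an ordered Abelian group, with its order topology, and let $\mathcal R=\langle R;+,<,\dots\rangle$ be an expansion of it to a first-order structure. $\mathcal R$ is \emph{definably complete} if every nonempty definable $X\subseteq R$ that is bounded above in $R$ has a least upper bound in $R$. An \emph{inp-pattern of depth $\kappa$} (in a single variable $x$) consists of formulas $\varphi_i(x;\bar y_i)$, positive integers $k_i$ ($i<\kappa$), and tuples $\bar a_{i,j}$ ($i<\kappa$, $j<\omega$) from some model of $\mathrm{Th}(\mathcal R)$ such that for each $i$ the row $\{\varphi_i(x;\bar a_{i,j}):j<\omega\}$ is $k_i$-inconsistent (the formulas for any $k_i$ distinct indices $j$ are jointly inconsistent), and for each $\eta:\kappa\to\omega$ the partial type $\{\varphi_i(x;\bar a_{i,\eta(i)}):i<\kappa\}$ is consistent. The \emph{burden} of $\mathcal R$ is $\lambda$ if the least cardinal $\kappa$ for which there is no inp-pattern of depth $\kappa$ is $\lambda^+$; thus burden $2$ means that there is an inp-pattern of depth $2$ but none of depth $3$. A set $D\subseteq R$ is \emph{discrete} if its subspace topology is discrete. For discrete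 $D$ let $D'=\{S_D(a)-a : a\in D \text{ and } S_D(a):=\min\{b\in D: b>a\}\text{ exists}\}$. A discrete set $E\subseteq R$ is \emph{pseudo-arithmetic} if $|E'|=1$. \textbf{Theorem.} Let $\mathcal R=\langle R;+,<,\dots\rangle$ be a definably complete expansion of a divisible ordered Abelian group, of burden $2$, and let $D\subseteq R$ be an infinite discrete set definable in $\mathcal R$. Then there is a pseudo-arithmetic set $E\subseteq R$, definable in $\mathcal R$, such that $D$ is definable in $\langle R;+,<,E\rangle$. -/

import Mathlib

universe u v w

namespace PseudoArith

/-! ### The languages of `⟨R; +, <⟩` and `⟨R; +, <, E⟩` -/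

/-- The only function symbol is the binary symbol `+`. -/
inductive AddFunc : ℕ → Type
  | add : AddFunc 2

/-- The only relation symbol is the binary symbol `<`. -/
inductive LtRel : ℕ → Type
  | lt : LtRel 2

/-- The relation symbols `<` (binary) and `E` (unary). -/
inductive LtPredRel : ℕ → Type
  | lt : LtPredRel 2
  | pred : LtPredRel 1

/-- The language `{+, <}` of ordered Abelian groups. -/
def oag : FirstOrder.Language.{0, 0} := ⟨AddFunc, LtRel⟩

/-- The language `{+, <, E}` with a unary predicate symbol `E`. -/
def oagPred : FirstOrder.Language.{0, 0} := ⟨AddFunc, LtPredRel⟩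

/-- The structure `⟨R; +, <⟩`. -/
instance oagStructure (R : Type w) [Add R] [LT R] : oag.Structure R where
  funMap f x := match f with
    | AddFunc.add => x 0 + x 1
  RelMap r x := match r with
    | LtRel.lt => x 0 < x 1

/-- The structure `⟨R; +, <, E⟩`. -/
@[reducible] def oagPredStructure {R : Type w} [Add R] [LT R] (E : Set R) :
    oagPred.Structure R where
  funMap f x := match f with
    | AddFunc.add => x 0 + x 1
  RelMap r x := match r with
    | LtPredRel.lt => x 0 < x 1
    | LtPredRel.pred => x 0 ∈ E

/-! ### Definability (always with parameters) and definable completeness -/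

/-- `X ⊆ R` is definable, with parameters, in the `L`-structure `R`. -/
def IsDefinable (L : FirstOrder.Language.{u, v}) {R : Type w} [L.Structure R] (X : Set R) : Prop :=
  (Set.univ : Set R).Definable₁ L X

/-- `X ⊆ R` is definable, with parameters, in `⟨R; +, <, E⟩`. -/
def IsDefinableFrom {R : Type w} [Add R] [LT R] (E X : Set R) : Prop :=
  letI : oagPred.Structure R := oagPredStructure E
  IsDefinable oagPred X

/-- Every nonempty definable subset of `R` with an upper bound has a least upper bound. -/
def DefinablyComplete (L : FirstOrder.Language.{u, v}) (R : Type w) [L.Structure R] [Preorder R] : Prop :=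
  ∀ X : Set R, IsDefinable L X → X.Nonempty → BddAbove X → ∃ s, IsLUB X s

/-! ### Burden -/

/-- The formulas `φ i (x; y₁, …, y_{m i})`, the positive integers `k i` and the parameter tuples
`a i j` from `M` form an inp-pattern (in the single free variable `x`) with rows indexed by `I`:
each row is `k i`-inconsistent, and for each `η : I → ℕ` the partial type
`{φ i (x; a i (η i)) : i ∈ I}` is consistent, that is, finitely satisfiable in `M`. -/
structure IsInpPattern {L : FirstOrder.Language.{u, v}} (M : Type w) [L.Structure M] {I : Type}
    (m : I → ℕ) (φ : ∀ i, L.Formula (Unit ⊕ Fin (m i))) (k : I → ℕ)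
    (a : ∀ i, ℕ → Fin (m i) → M) : Prop where
  pos : ∀ i, 0 < k i
  row_inconsistent : ∀ i, ∀ s : Finset ℕ, s.card = k i →
    ¬ ∃ b : M, ∀ j ∈ s, (φ i).Realize (Sum.elim (fun _ => b) (a i j))
  path_consistent : ∀ η : I → ℕ, ∀ s : Finset I,
    ∃ b : M, ∀ i ∈ s, (φ i).Realize (Sum.elim (fun _ => b) (a i (η i)))

/-- There is an inp-pattern of depth `κ` with parameters from some model of `T`. -/
def HasInpPattern {L : FirstOrder.Language.{u, v}} (T : L.Theory) (κ : Cardinal.{0}) : Prop :=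
  ∃ (I : Type) (M : FirstOrder.Language.Theory.ModelType.{u, v, w} T) (m : I → ℕ)
    (φ : ∀ i, L.Formula (Unit ⊕ Fin (m i))) (k : I → ℕ) (a : ∀ i, ℕ → Fin (m i) → M),
    Cardinal.mk I = κ ∧ IsInpPattern M m φ k a

/-- The theory of the structure `R` has burden `lam`: the least `κ` such that there is no
inp-pattern of depth `κ` is the successor cardinal of `lam`. (By Löwenheim–Skolem the universe of
the models used here is large enough to carry every inp-pattern.) -/
def HasBurden (L : FirstOrder.Language.{u, v}) (R : Type w) [L.Structure R] (lam : Cardinal.{0}) : Prop :=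
  IsLeast {κ : Cardinal.{0} | ¬ HasInpPattern.{u, v, max u v w} (L.completeTheory R) κ}
    (Order.succ lam)

/-! ### Difference sets and pseudo-arithmetic sets -/

/-- The difference set `D'`: all `S_D(a) - a`, where `a ∈ D` and `S_D(a)` is the least element of
`D` above `a`. -/
def differenceSet {R : Type w} [Sub R] [Preorder R] (D : Set R) : Set R :=
  {d | ∃ a ∈ D, ∃ b, IsLeast {x | x ∈ D ∧ a < x} b ∧ d = b - a}

/-- A discrete set `E` is pseudo-arithmetic if `E'` has exactly one element. -/
def IsPseudoArithmetic {R : Type w} [Sub R] [Preorder R] [TopologicalSpace R] (E : Set R) : Prop :=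
  IsDiscrete E ∧ ∃ η : R, differenceSet E = {η}

end PseudoArith

/-! Burden 2 enters through one obstruction, `exists_pattern_bound`. If a definable set has many
points pairwise at distance at least `r`, and another has many isolated points in `[0, r)`, then
with the dense order this gives three independent coordinates: `x = a + b + d`, with `a` and `b`
from the two sets and `d` tiny. Arbitrarily large finite grids of this kind would give, by
compactness, an inp-pattern of depth 3, so their size is bounded uniformly in the parameters.

Playing such sets against each other tames every definable discrete `D`. It is finite on intervals
of a fixed length (`PtDisc.loc`), so definable nonempty bounded subsets have extrema and induction
along `D` works. Its difference set is finite (`finite_differenceSet`), so only finitely many local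
patterns occur in windows of a fixed length `l`. By pigeonhole each point, apart from finitely many,
is within boundedly many steps of a window that `D` repeats after one of finitely many shifts `t`.
Points where `D` and its shift disagree, followed by a disagreement-free stretch of length `l`, are
finite in number. Hence finitely many intervals on which `D` is periodic cover all but finitely many
points of `D` (`exists_periodicPieces`).

On one such interval the definable periods form a possibly nonstandard arithmetic progression `P`,
and `D` is recovered from `P` and finitely many points (`IsWeakPiece.fromAPs`). Finally, the
differences of any two infinite definable progressions are commensurable (`IsAP.commensurable`).
Suitable multiples of the finitely many progressions share one difference and are nested, and the
largest of them is `E`. -/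

namespace PseudoArith

open FirstOrder

/-! ### Closure properties of definability with parameters -/

section Framework

variable {L : FirstOrder.Language.{u, v}} {R : Type w} [L.Structure R] {α β : Type}

/-- A predicate on `α`-tuples is definable with parameters. -/
def DefP (L : FirstOrder.Language.{u, v}) [L.Structure R] (P : (α → R) → Prop) : Prop :=
  (Set.univ : Set R).Definable L {v | P v}

/-- A function of `α`-tuples is definable with parameters. -/
def DefF (L : FirstOrder.Language.{u, v}) [L.Structure R] (f : (α → R) → R) : Prop :=
  (Set.univ : Set R).DefinableFun L f

theorem DefP.not {P : (α → R) → Prop} (h : DefP L P) : DefP L fun v => ¬ P v :=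
  Set.Definable.compl h

theorem DefP.and {P Q : (α → R) → Prop} (h : DefP L P) (h' : DefP L Q) :
    DefP L fun v => P v ∧ Q v :=
  Set.Definable.inter h h'

theorem DefP.or {P Q : (α → R) → Prop} (h : DefP L P) (h' : DefP L Q) :
    DefP L fun v => P v ∨ Q v :=
  Set.Definable.union h h'

theorem DefP.congr {P Q : (α → R) → Prop} (h : DefP L P) (hPQ : ∀ v, Q v ↔ P v) : DefP L Q := by
  rwa [show Q = P from funext fun v => propext (hPQ v)]

theorem DefP.imp {P Q : (α → R) → Prop} (h : DefP L P) (h' : DefP L Q) :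
    DefP L fun v => P v → Q v :=
  (h.not.or h').congr fun _ => imp_iff_not_or

theorem DefP.iff {P Q : (α → R) → Prop} (h : DefP L P) (h' : DefP L Q) :
    DefP L fun v => (P v ↔ Q v) :=
  ((h.imp h').and (h'.imp h)).congr fun _ => iff_iff_implies_and_implies

theorem DefP.const (p : Prop) : DefP L fun _ : α → R => p := by
  by_cases hp : p
  · simp [DefP, hp]
  · simp [DefP, hp]

theorem DefP.ex {P : (α → R) → R → Prop}
    (h : DefP L fun w : Option α → R => P (fun i => w (some i)) (w none)) :
    DefP L fun v => ∃ x, P v x := by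
  have h1 : (Set.univ : Set R).Definable L
      {w : α ⊕ Unit → R | P (fun i => w (Sum.inl i)) (w (Sum.inr ()))} :=
    Set.Definable.preimage_comp (fun o : Option α => o.elim (Sum.inr ()) Sum.inl) h
  refine DefP.congr h1.exists_of_finite fun v => ?_
  exact ⟨fun ⟨x, hx⟩ => ⟨fun _ => x, hx⟩, fun ⟨x, hx⟩ => ⟨x (), hx⟩⟩

theorem DefP.all {P : (α → R) → R → Prop}
    (h : DefP L fun w : Option α → R => P (fun i => w (some i)) (w none)) :
    DefP L fun v => ∀ x, P v x :=
  (DefP.ex (P := fun v x => ¬ P v x) h.not).not.congr fun v => by simp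

theorem DefP.reindex {P : (α → R) → Prop} (h : DefP L P) (f : α → β) :
    DefP L fun w : β → R => P fun i => w (f i) :=
  Set.Definable.preimage_comp f h

theorem DefP.comp [Finite α] {P : (α → R) → Prop} (h : DefP L P) {f : α → (β → R) → R}
    (hf : ∀ i, DefF L (f i)) : DefP L fun w : β → R => P fun i => f i w :=
  Set.Definable.preimage_map (F := fun w i => f i w) hf h

theorem DefF.reindex {g : (α → R) → R} (h : DefF L g) (f : α → β) :
    DefF L fun w : β → R => g fun i => w (f i) :=
  Set.Definable.preimage_comp (Option.map f) h

theorem DefF.comp [Finite α] {g : (α → R) → R} (h : DefF L g) {f : α → (β → R) → R}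
    (hf : ∀ i, DefF L (f i)) : DefF L fun w : β → R => g fun i => f i w :=
  Set.DefinableFun.comp (g := fun w i => f i w) hf h

theorem DefF.var (i : α) : DefF L fun v : α → R => v i :=
  Set.DefinableFun.proj L

theorem DefF.const (c : R) : DefF L fun _ : α → R => c :=
  FirstOrder.Language.definableFun_const L α (Set.mem_univ c)

theorem DefF.eq {f g : (α → R) → R} (hf : DefF L f) (hg : DefF L g) :
    DefP L fun v => f v = g v :=
  Set.DefinableFun.ofPred_eq hf hg

theorem DefF.of_graph {f : (α → R) → R} {P : (α → R) → R → Prop}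
    (h : DefP L fun w : Option α → R => P (fun i => w (some i)) (w none))
    (hP : ∀ v x, P v x ↔ f v = x) : DefF L f := by
  refine DefP.congr h fun w => ?_
  exact (hP _ _).symm

/-- A definable set `X`, applied to a definable function. -/
theorem IsDefinable.mem {X : Set R} (hX : IsDefinable L X) {f : (α → R) → R} (hf : DefF L f) :
    DefP L fun v => f v ∈ X :=
  DefP.comp (α := Fin 1) (P := fun v => v 0 ∈ X) hX (f := fun _ => f) fun _ => hf

theorem isDefinable_of_defP {X : Set R} {P : R → Prop}
    (h : DefP L fun v : Fin 1 → R => P (v 0)) (hX : ∀ x, x ∈ X ↔ P x) : IsDefinable L X :=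
  DefP.congr h fun v => hX (v 0)

/-- A family of sets, definable uniformly in the parameters. -/
def DefFam (L : FirstOrder.Language.{u, v}) [L.Structure R] (A : (α → R) → Set R) : Prop :=
  DefP L fun w : Option α → R => w none ∈ A fun i => w (some i)

theorem DefFam.mem [Finite α] {A : (α → R) → Set R} (hA : DefFam L A) {f : (β → R) → R}
    {g : α → (β → R) → R} (hf : DefF L f) (hg : ∀ i, DefF L (g i)) :
    DefP L fun v => f v ∈ A fun i => g i v :=
  DefP.comp (P := fun w : Option α → R => w none ∈ A fun i => w (some i)) hA
    (f := fun o => o.elim f g) (by rintro (_ | i) <;> simp [hf, hg])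

theorem DefFam.isDefinable [Finite α] {A : (α → R) → Set R} (hA : DefFam L A) (y : α → R) :
    IsDefinable L (A y) :=
  hA.mem (DefF.var 0) fun i => DefF.const (y i)

theorem IsDefinable.defFam {X : Set R} (hX : IsDefinable L X) :
    DefFam L fun _ : α → R => X :=
  hX.mem (DefF.var none)

theorem IsDefinable.union {X Y : Set R} (hX : IsDefinable L X) (hY : IsDefinable L Y) :
    IsDefinable L (X ∪ Y) :=
  DefP.or hX hY

theorem IsDefinable.inter {X Y : Set R} (hX : IsDefinable L X) (hY : IsDefinable L Y) :
    IsDefinable L (X ∩ Y) :=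
  DefP.and hX hY

theorem IsDefinable.diff {X Y : Set R} (hX : IsDefinable L X) (hY : IsDefinable L Y) :
    IsDefinable L (X \ Y) :=
  DefP.and hX (DefP.not hY)

theorem isDefinable_singleton (a : R) : IsDefinable L {a} :=
  DefF.eq (DefF.var 0) (DefF.const a)

theorem isDefinable_empty : IsDefinable L (∅ : Set R) := DefP.const False

theorem isDefinable_of_finite {X : Set R} (hX : X.Finite) : IsDefinable L X := by
  induction X, hX using Set.Finite.induction_on with
  | empty => exact isDefinable_empty
  | insert _ _ ih => exact (isDefinable_singleton _).union ih

end Framework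

/-! ### Definability of the ordered group operations -/

section OrderedGroup

/-- Addition and order are definable in the structure. -/
class DefinableOAG (L : FirstOrder.Language.{u, v}) (R : Type w) [L.Structure R] [Add R] [LT R] :
    Prop where
  add : DefF L fun v : Fin 2 → R => v 0 + v 1
  lt : DefP L fun v : Fin 2 → R => v 0 < v 1

variable {L : FirstOrder.Language.{u, v}} {R : Type w} [L.Structure R] {α : Type}

theorem DefF.add [Add R] [LT R] [DefinableOAG L R] {f g : (α → R) → R} (hf : DefF L f)
    (hg : DefF L g) : DefF L fun v => f v + g v := by
  have h := DefF.comp (L := L) (R := R) DefinableOAG.add (f := ![f, g])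
    (by intro i; fin_cases i <;> assumption)
  exact h

theorem DefP.lt [Add R] [LT R] [DefinableOAG L R] {f g : (α → R) → R} (hf : DefF L f)
    (hg : DefF L g) : DefP L fun v => f v < g v := by
  have h := DefP.comp (L := L) (R := R) DefinableOAG.lt (f := ![f, g])
    (by intro i; fin_cases i <;> assumption)
  exact h

variable [AddCommGroup R] [LinearOrder R] [DefinableOAG L R]

theorem DefP.le {f g : (α → R) → R} (hf : DefF L f) (hg : DefF L g) :
    DefP L fun v => f v ≤ g v :=
  (DefP.lt hg hf).not.congr fun _ => not_lt.symm

theorem DefF.sub {f g : (α → R) → R} (hf : DefF L f) (hg : DefF L g) :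
    DefF L fun v => f v - g v := by
  refine DefF.of_graph (P := fun v x => x + g v = f v) ?_ fun v x => ?_
  · exact DefF.eq (DefF.add (DefF.var none) (hg.reindex some))
      (hf.reindex some)
  · rw [sub_eq_iff_eq_add, eq_comm]

theorem DefF.neg {f : (α → R) → R} (hf : DefF L f) : DefF L fun v => - f v := by
  simpa using DefF.sub (L := L) (DefF.const 0) hf

theorem DefF.nsmul {f : (α → R) → R} (hf : DefF L f) (n : ℕ) : DefF L fun v => n • f v := by
  induction n with
  | zero => simpa using DefF.const (L := L) (0 : R)
  | succ n ih => simpa only [succ_nsmul] using ih.add hf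

theorem DefF.abs [IsOrderedAddMonoid R] {f : (α → R) → R} (hf : DefF L f) : DefF L fun v => |f v| := by
  refine DefF.of_graph (P := fun v x => (0 ≤ f v ∧ f v = x) ∨ (f v < 0 ∧ - f v = x) ) ?_ ?_
  · have h := hf.reindex some
    exact ((DefP.le (DefF.const 0) h).and (h.eq (DefF.var none))).or
      ((DefP.lt h (DefF.const 0)).and (h.neg.eq (DefF.var none)))
  · intro v x
    rcases le_or_gt 0 (f v) with h | h
    · simp [h, abs_of_nonneg h, not_lt.2 h]
    · simp [h, abs_of_neg h, not_le.2 h]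

theorem isDefinable_Ici (a : R) : IsDefinable L (Set.Ici a) :=
  DefP.le (DefF.const a) (DefF.var 0)

theorem isDefinable_Iic (a : R) : IsDefinable L (Set.Iic a) :=
  DefP.le (DefF.var 0) (DefF.const a)

theorem isDefinable_Icc (a b : R) : IsDefinable L (Set.Icc a b) :=
  (isDefinable_Ici a).inter (isDefinable_Iic b)

theorem IsDefinable.neg {X : Set R} (hX : IsDefinable L X) : IsDefinable L {x | -x ∈ X} :=
  hX.mem (DefF.var 0).neg

theorem definableOAG_of_expansion {L : FirstOrder.Language.{u, v}} {R : Type w} [AddCommGroup R]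
    [LinearOrder R] [L.Structure R] (ι : oag →ᴸ L) [ι.IsExpansionOn R] : DefinableOAG L R where
  add := by
    have h := Set.DefinableFun.fun_symbol (L := L) (M := R)
      (ι.onFunction (AddFunc.add : oag.Functions 2))
    rw [show (Language.Structure.funMap (ι.onFunction (AddFunc.add : oag.Functions 2)) :
      (Fin 2 → R) → R) = fun v => v 0 + v 1 from
      funext fun v => ι.map_onFunction (AddFunc.add : oag.Functions 2) v] at h
    exact Set.DefinableFun.of_empty h
  lt := by
    refine ⟨Language.Relations.formula
      (Language.LHom.onRelation (L.lhomWithConstants _)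
        (ι.onRelation (LtRel.lt : oag.Relations 2))) fun i => Language.Term.var i, ?_⟩
    ext v
    simp only [Set.mem_ofPred_eq, Language.Formula.realize_rel, Language.LHom.map_onRelation,
      Language.Term.realize_var]
    exact (ι.map_onRelation (LtRel.lt : oag.Relations 2) v).symm.to_iff

end OrderedGroup

section Predicate

variable {R : Type w} [AddCommGroup R] [LinearOrder R]

theorem definableOAG_oagPred (E : Set R) :
    letI := oagPredStructure E
    DefinableOAG oagPred R := by
  let := oagPredStructure E
  refine ⟨Set.DefinableFun.of_empty
    (Set.DefinableFun.fun_symbol (L := oagPred) (M := R) (n := 2) AddFunc.add), ?_⟩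
  refine ⟨Language.Relations.formula (Language.LHom.onRelation (oagPred.lhomWithConstants _)
      (LtPredRel.lt : oagPred.Relations 2)) fun i => Language.Term.var i, ?_⟩
  ext v
  simp only [Set.mem_ofPred_eq, Language.Formula.realize_rel, Language.Term.realize_var]
  rfl

theorem isDefinableFrom_self (E : Set R) : IsDefinableFrom E E := by
  let := oagPredStructure E
  refine ⟨Language.Relations.formula (Language.LHom.onRelation (oagPred.lhomWithConstants _)
      (LtPredRel.pred : oagPred.Relations 1)) fun i => Language.Term.var i, ?_⟩
  ext v
  simp only [Set.mem_ofPred_eq, Language.Formula.realize_rel, Language.Term.realize_var]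
  rfl

end Predicate

end PseudoArith

namespace PseudoArith

open FirstOrder

/-! ### From finite grids to inp-patterns -/

section Burden

variable {L : FirstOrder.Language.{u, v}} {R : Type w} [L.Structure R] {α : Type}

/-- Inp-patterns use formulas of `L` without constants, so the constants of the definition join the
family's parameters in a single finite tuple `c y`. -/
theorem DefFam.exists_formula [Nonempty R] {A : (α → R) → Set R} (hA : DefFam L A) :
    ∃ (m : ℕ) (φ : L.Formula (Unit ⊕ Fin m)) (c : (α → R) → Fin m → R),
      ∀ y x, φ.Realize (Sum.elim (fun _ => x) (c y)) ↔ x ∈ A y := by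
  classical
  obtain ⟨φ, hφ⟩ := Set.definable_iff_exists_formula_sum.1 hA
  let s := φ.freeVarFinset
  let e := s.equivFin
  let f : s → Unit ⊕ Fin s.card := fun i =>
    Sum.elim (fun _ => Sum.inr (e i)) (fun o => o.elim (Sum.inl ()) fun _ => Sum.inr (e i)) i.1
  -- The slot belonging to the object variable `none` is filled arbitrarily: `f` sends that variable
  -- to the `Unit` side, so the slot is never read.
  let c : (α → R) → Fin s.card → R := fun y j =>
    Sum.elim Subtype.val (fun o => o.elim (Classical.arbitrary R) y) (e.symm j).1
  refine ⟨s.card, φ.restrictFreeVar f, c, fun y x => ?_⟩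
  have key := Language.BoundedFormula.realize_restrictFreeVar (φ := φ) (f := f)
    (v := Sum.elim (fun _ => x) (c y)) (xs := (default : Fin 0 → R))
    (Sum.elim Subtype.val fun o => o.elim x y) (by
      rintro ⟨_ | _ | a, hi⟩ <;> simp [f, c])
  refine key.trans ?_
  have := Set.ext_iff.1 hφ fun o => o.elim x y
  exact this.symm

/-- Compactness: if finite patterns of every size `N` existed, the sequences of their parameters
would form an infinite pattern in an ultrapower of `R`, since any fixed column index `j` lies below
almost every `N`. -/
theorem exists_bound_of_not_hasInpPattern [Nonempty R]
    (h : ¬ HasInpPattern.{u, v, max u v w} (L.completeTheory R) 3)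
    {P : Fin 3 → (α → R) → Set R} (hP : ∀ i, DefFam L (P i)) :
    ∃ N : ℕ, ∀ a : Fin 3 → ℕ → α → R,
      (∀ i, ∀ j < N, ∀ k < N, j ≠ k → Disjoint (P i (a i j)) (P i (a i k))) →
      ¬ ∀ η : Fin 3 → ℕ, (∀ i, η i < N) → ∃ x, ∀ i, x ∈ P i (a i (η i)) := by
  by_contra! hcon
  choose a hdis hcons using hcon
  choose m φ c hc using fun i => (hP i).exists_formula
  let U : Ultrafilter ℕ := Filter.hyperfilter ℕ
  let M := (U : Filter ℕ).Product fun _ => R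
  have hM : M ⊨ L.completeTheory R := by
    rw [Language.Theory.model_iff]
    intro ψ hψ
    exact (Language.Ultraproduct.sentence_realize ψ).2 (Filter.Eventually.of_forall fun _ => hψ)
  let M' : (L.completeTheory R).ModelType := Language.Theory.ModelType.of _ M
  let M'' : Language.Theory.ModelType.{u, v, max u v w} (L.completeTheory R) :=
    Language.Theory.ModelType.ulift.{u, v, w, max u v w} M'
  let e : M ≃[L] M'' := Equiv.inducedStructureEquiv _
  let b : ∀ i, ℕ → Fin (m i) → M := fun i j l => ((fun N => c i (a N i j) l : ℕ → R) : M)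
  have real : ∀ i j (x : ℕ → R), (φ i).Realize (Sum.elim (fun _ => (x : M)) (b i j)) ↔
      ∀ᶠ N in U, x N ∈ P i (a N i j) := by
    intro i j x
    have h1 := Language.Ultraproduct.realize_formula_cast (u := U) (φ i)
      (Sum.elim (fun _ => x) (fun l N => c i (a N i j) l))
    have h2 : (Sum.elim (fun _ : Unit => (x : M)) (b i j)) = fun k =>
        ((Sum.elim (fun _ : Unit => x) (fun l N => c i (a N i j) l) k : ℕ → R) : M) := by
      ext (_ | _) <;> rfl
    rw [h2]
    refine h1.trans (Filter.eventually_congr (Filter.Eventually.of_forall fun N => ?_))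
    rw [← hc i (a N i j) (x N)]
    refine iff_of_eq (congrArg _ ?_)
    ext (_ | _) <;> rfl
  have real' : ∀ i j (x : M), (φ i).Realize (Sum.elim (fun _ => e x) fun l => e (b i j l)) ↔
      (φ i).Realize (Sum.elim (fun _ => x) (b i j)) := by
    intro i j x
    rw [← Language.StrongHomClass.realize_formula e (φ i)]
    refine iff_of_eq (congrArg _ ?_)
    ext (_ | _) <;> rfl
  have large : ∀ j : ℕ, ∀ᶠ N in U, j < N := fun j =>
    (Filter.eventually_gt_atTop j).filter_mono (Nat.hyperfilter_le_atTop)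
  refine h ⟨Fin 3, M'', m, φ, fun _ => 2, fun i j l => e (b i j l), by simp, ?_, ?_, ?_⟩
  · simp
  · rintro i s hs ⟨z, hz⟩
    obtain ⟨j, k, hjk, rfl⟩ := Finset.card_eq_two.1 hs
    obtain ⟨z, rfl⟩ := e.surjective z
    obtain ⟨x, rfl⟩ := Quotient.exists_rep z
    have hj := (real i j x).1 ((real' i j _).1 (hz j (by simp)))
    have hk := (real i k x).1 ((real' i k _).1 (hz k (by simp)))
    obtain ⟨N, ⟨⟨h1, h2⟩, h3⟩, h4⟩ := (((hj.and hk).and (large j)).and (large k)).exists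
    exact Set.disjoint_left.1 (hdis N i j h3 k h4 hjk) h1 h2
  · intro η s
    have hx : ∀ N, ∃ x, (∀ i, η i < N) → ∀ i, x ∈ P i (a N i (η i)) := by
      intro N
      by_cases hN : ∀ i, η i < N
      · obtain ⟨x, hx⟩ := hcons N η hN
        exact ⟨x, fun _ => hx⟩
      · exact ⟨Classical.arbitrary R, fun h => (hN h).elim⟩
    choose x hx using hx
    refine ⟨e (x : M), fun i _ => (real' i (η i) _).2 ((real i (η i) x).2 ?_)⟩
    filter_upwards [large (η 0), large (η 1), large (η 2)] with N h0 h1 h2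
    refine hx N (fun i => ?_) i
    fin_cases i <;> assumption

end Burden

end PseudoArith

namespace PseudoArith

set_option linter.unusedSectionVars false

open FirstOrder

/-! ### The basic obstruction given by depth three -/

section

variable {R : Type w} [AddCommGroup R] [LinearOrder R]

/-- The points of `A` at distance at least `r` from all other points of `A`. -/
def isolatedBy (A : Set R) (r : R) : Set R :=
  {a | a ∈ A ∧ ∀ b, b ∈ A → b ≠ a → r ≤ |b - a|}

/-- Every point of `X` is isolated in `X`. -/
def PtDisc (X : Set R) : Prop := ∀ b, b ∈ X → ∃ δ, 0 < δ ∧ b ∈ isolatedBy X δ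

end

/-- The standing assumptions: a definably complete, densely ordered structure without inp-patterns
of depth three, in which some infinite discrete set is definable. -/
class Tame (L : FirstOrder.Language.{u, v}) (R : Type w) [L.Structure R] [AddCommGroup R]
    [LinearOrder R] : Prop where
  complete : DefinablyComplete L R
  dense : DenselyOrdered R
  burden : ¬ HasInpPattern.{u, v, max u v w} (L.completeTheory R) 3
  exists_discrete : ∃ D : Set R, IsDefinable L D ∧ D.Infinite ∧ PtDisc D

section Pattern

variable {L : FirstOrder.Language.{u, v}} {R : Type w} [L.Structure R] {α β : Type}
  [AddCommGroup R] [LinearOrder R]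

theorem isolatedBy_anti (A : Set R) {r s : R} (h : s ≤ r) : isolatedBy A r ⊆ isolatedBy A s :=
  fun _ ha => ⟨ha.1, fun b hb hne => h.trans (ha.2 b hb hne)⟩

theorem exists_pos_forall_finset {κ : Type*} [Nontrivial R] [IsOrderedAddMonoid R] (t : Finset κ)
    {Q : κ → R → Prop}
    (hQ : ∀ b ∈ t, ∃ δ, 0 < δ ∧ Q b δ) (hanti : ∀ b δ ε, 0 < ε → ε ≤ δ → Q b δ → Q b ε) :
    ∃ δ, 0 < δ ∧ ∀ b ∈ t, Q b δ := by
  classical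
  induction t using Finset.induction_on with
  | empty => simpa using exists_zero_lt
  | insert b t hb ih =>
    obtain ⟨δ, hδ, h1⟩ := ih fun b hb => hQ b (Finset.mem_insert_of_mem hb)
    obtain ⟨ε, hε, h2⟩ := hQ b (Finset.mem_insert_self _ _)
    refine ⟨min δ ε, lt_min hδ hε, fun c hc => ?_⟩
    rcases Finset.mem_insert.1 hc with rfl | hc
    · exact hanti _ _ _ (lt_min hδ hε) (min_le_right _ _) h2
    · exact hanti _ _ _ (lt_min hδ hε) (min_le_left _ _) (h1 c hc)

theorem exists_injOn_of_le_card {κ : Type*} [Nonempty κ] {s : Finset κ} {N : ℕ} (h : N ≤ s.card) :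
    ∃ f : ℕ → κ, (∀ j < N, f j ∈ s) ∧ ∀ j < N, ∀ k < N, f j = f k → j = k := by
  have e := s.equivFin.symm
  refine ⟨fun j => if hj : j < s.card then e ⟨j, hj⟩ else Classical.arbitrary κ, fun j hj => ?_,
    fun j hj k hk hjk => ?_⟩
  · simp [hj.trans_le h]
  · simpa [hj.trans_le h, hk.trans_le h, Subtype.ext_iff] using hjk

variable [IsOrderedAddMonoid R]

theorem isolatedBy_unique {A : Set R} {r a₁ a₂ z₁ z₂ : R} (h₁ : a₁ ∈ isolatedBy A r)
    (h₂ : a₂ ∈ isolatedBy A r) (hz₁ : 0 ≤ z₁) (hz₁' : z₁ < r) (hz₂ : 0 ≤ z₂) (hz₂' : z₂ < r)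
    (h : a₁ + z₁ = a₂ + z₂) : a₁ = a₂ := by
  by_contra hne
  have := h₁.2 a₂ h₂.1 (Ne.symm hne)
  have h' : a₂ - a₁ = z₁ - z₂ := by rw [sub_eq_sub_iff_add_eq_add, ← h, add_comm]
  rw [h'] at this
  exact absurd this (not_le.2 (abs_lt.2 ⟨by grind, by grind⟩))

variable [DefinableOAG L R]

theorem DefP.mem_isolatedBy [Finite α] {A : (α → R) → Set R} (hA : DefFam L A) {f r : (β → R) → R}
    {g : α → (β → R) → R} (hf : DefF L f) (hg : ∀ i, DefF L (g i)) (hr : DefF L r) :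
    DefP L fun v => f v ∈ isolatedBy (A fun i => g i v) (r v) := by
  have hf' := hf.reindex some
  have hr' := hr.reindex some
  have hg' := fun i => (hg i).reindex some
  refine (hA.mem hf hg).and (DefP.all ((hA.mem (DefF.var none) hg').imp (DefP.imp ?_ ?_)))
  · exact (DefF.eq (DefF.var none) hf').not
  · exact DefP.le hr' (DefF.abs (DefF.sub (DefF.var none) hf'))

/-- Three rows read off the coordinates of `x = a + b + d`: the block of length `r` containing `x`,
the block of length `σ` containing `x` relative to `A`, and the exact offset `d`. Isolation makes
the blocks disjoint, so each coordinate is determined by `x`, while all combinations occur. -/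
theorem exists_pattern_bound [Tame L R] [Nontrivial R] [Finite α] {A B : (α → R) → Set R}
    (hA : DefFam L A) (hB : DefFam L B) :
    ∃ N : ℕ, ∀ (y : α → R) (r : R) (s t : Finset R), N ≤ s.card → N ≤ t.card → 0 < r →
      (∀ a ∈ s, a ∈ isolatedBy (A y) r) →
      (∀ b ∈ t, 0 ≤ b ∧ b < r ∧ ∃ δ, 0 < δ ∧ b ∈ isolatedBy (B y) δ) → False := by
  have : DenselyOrdered R := Tame.dense L
  let r : α ⊕ Fin 3 := Sum.inr 0
  let s : α ⊕ Fin 3 := Sum.inr 1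
  let c : α ⊕ Fin 3 := Sum.inr 2
  let P : Fin 3 → (α ⊕ Fin 3 → R) → Set R := ![
    fun w => {x | w c ≤ x ∧ x < w c + w r},
    fun w => {x | ∃ a, a ∈ isolatedBy (A fun i => w (Sum.inl i)) (w r) ∧
      w c ≤ x - a ∧ x - a < w c + w s},
    fun w => {x | ∃ a, a ∈ isolatedBy (A fun i => w (Sum.inl i)) (w r) ∧
      ∃ b, b ∈ isolatedBy (B fun i => w (Sum.inl i)) (w s) ∧ 0 ≤ b ∧ b + w s ≤ w r ∧
        x = a + b + w c}]
  have hP : ∀ i, DefFam L (P i) := by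
    intro i
    fin_cases i
    · apply_rules [DefP.and, DefP.le, DefP.lt, DefF.add, DefF.var]
    · refine DefP.ex (DefP.and ?_ (DefP.and ?_ ?_))
      · exact DefP.mem_isolatedBy hA (DefF.var _) (fun i => DefF.var _) (DefF.var _)
      all_goals apply_rules [DefP.le, DefP.lt, DefF.add, DefF.sub, DefF.var]
    · refine DefP.ex (DefP.and ?_ (DefP.ex (DefP.and ?_ ?_)))
      · exact DefP.mem_isolatedBy hA (DefF.var _) (fun i => DefF.var _) (DefF.var _)
      · exact DefP.mem_isolatedBy hB (DefF.var _) (fun i => DefF.var _) (DefF.var _)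
      · apply_rules [DefP.and, DefP.le, DefP.lt, DefF.add, DefF.sub, DefF.var, DefF.const, DefF.eq]
  obtain ⟨N, hN⟩ := exists_bound_of_not_hasInpPattern (Tame.burden (L := L) (R := R)) hP
  refine ⟨N, fun y ρ S T hS hT hρ hSA hTB => ?_⟩
  -- One `σ` serves the finitely many `b`; the condition `b + σ ≤ ρ` keeps each small block inside
  -- the large block it belongs to.
  obtain ⟨σ, hσ, hTσ⟩ : ∃ σ, 0 < σ ∧ ∀ b ∈ T, b ∈ isolatedBy (B y) σ ∧ b + σ ≤ ρ := by
    refine exists_pos_forall_finset T (fun b hb => ?_) fun b δ ε hε hεδ h =>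
      ⟨isolatedBy_anti _ hεδ h.1, le_trans (by simpa using hεδ) h.2⟩
    obtain ⟨-, h1, δ, hδ, h2⟩ := hTB b hb
    refine ⟨min δ (ρ - b), lt_min hδ (sub_pos.2 h1), isolatedBy_anti _ (min_le_left _ _) h2, ?_⟩
    have := min_le_right δ (ρ - b)
    rw [← le_sub_iff_add_le']
    exact this
  -- Density of the order supplies the third coordinate.
  obtain ⟨C, hC, hCN⟩ := (Set.Ioo_infinite hσ).exists_subset_card_eq N
  obtain ⟨a, ha, ha'⟩ := exists_injOn_of_le_card hS
  obtain ⟨b, hb, hb'⟩ := exists_injOn_of_le_card hT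
  obtain ⟨d, hd, hd'⟩ := exists_injOn_of_le_card hCN.ge
  let par : R → α ⊕ Fin 3 → R := fun z => Sum.elim y ![ρ, σ, z]
  refine hN (fun i j => par (![a, b, d] i j)) ?_ ?_
  · intro i j hj k hk hjk
    rw [Set.disjoint_left]
    fin_cases i
    · rintro x ⟨h1, h2⟩ ⟨h3, h4⟩
      refine hjk (ha' j hj k hk ?_)
      refine isolatedBy_unique (hSA _ (ha j hj)) (hSA _ (ha k hk)) (z₁ := x - a j) (z₂ := x - a k) ?_ ?_ ?_ ?_ (by abel)
      all_goals simp [par, r, c] at h1 h2 h3 h4 ⊢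
      all_goals grind
    · rintro x ⟨a₁, h1, h2, h3⟩ ⟨a₂, h4, h5, h6⟩
      refine hjk (hb' j hj k hk ?_)
      obtain ⟨hbj, hbj'⟩ := hTσ _ (hb j hj)
      obtain ⟨hbk, hbk'⟩ := hTσ _ (hb k hk)
      have p1 := (hTB _ (hb j hj)).1
      have p2 := (hTB _ (hb k hk)).1
      simp [par, r, c, s] at h1 h2 h3 h4 h5 h6
      have : a₁ = a₂ := isolatedBy_unique h1 h4 (z₁ := x - a₁) (z₂ := x - a₂) (by grind) (by grind) (by grind)
        (by grind) (by abel)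
      subst this
      exact isolatedBy_unique hbj hbk (z₁ := x - a₁ - b j) (z₂ := x - a₁ - b k) (by grind) (by grind) (by grind)
        (by grind) (by abel)
    · rintro x ⟨a₁, h1, b₁, h2, h3, h4, h5⟩ ⟨a₂, h1', b₂, h2', h3', h4', h5'⟩
      refine hjk (hd' j hj k hk ?_)
      have q1 := hC (hd j hj)
      have q2 := hC (hd k hk)
      simp [par, r, c, s] at h1 h2 h3 h4 h5 h1' h2' h3' h4' h5' q1 q2
      have : a₁ = a₂ := isolatedBy_unique h1 h1' (z₁ := b₁ + d j) (z₂ := b₂ + d k) (by grind) (by grind) (by grind)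
        (by grind) (by grind)
      subst this
      have : b₁ = b₂ := isolatedBy_unique h2 h2' (z₁ := d j) (z₂ := d k) (by grind) (by grind) (by grind)
        (by grind) (by grind)
      subst this
      grind
  · intro η hη
    refine ⟨a (η 0) + b (η 1) + d (η 2), fun i => ?_⟩
    have hA := hSA _ (ha _ (hη 0))
    have p1 := (hTB _ (hb _ (hη 1))).1
    obtain ⟨hB, hB'⟩ := hTσ _ (hb _ (hη 1))
    have hD := hC (hd _ (hη 2))
    simp at hD
    fin_cases i
    · refine ⟨?_, ?_⟩ <;> simp [par, r, c] <;> grind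
    · refine ⟨a (η 0), hA, ?_, ?_⟩ <;> simp [par, s, c] <;> grind
    · exact ⟨a (η 0), hA, b (η 1), hB, p1, hB', rfl⟩

end Pattern

end PseudoArith

namespace PseudoArith

set_option linter.unusedSectionVars false

open FirstOrder

/-! ### Definable discrete sets are locally finite, with finite difference set -/

section Discrete

variable {R : Type w} [AddCommGroup R] [LinearOrder R]

/-- `X` meets all half-open intervals of some fixed length in finite sets. -/
def Loc (X : Set R) : Prop := ∃ ε, 0 < ε ∧ ∀ a, (X ∩ Set.Ico a (a + ε)).Finite

theorem Loc.mono {X Y : Set R} (hY : Loc Y) (h : X ⊆ Y) : Loc X := by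
  obtain ⟨ε, hε, hY⟩ := hY
  exact ⟨ε, hε, fun a => (hY a).subset (Set.inter_subset_inter_left _ h)⟩

theorem PtDisc.of_subsingleton [Nontrivial R] [IsOrderedAddMonoid R] {X : Set R}
    (hX : X.Subsingleton) : PtDisc X := by
  obtain ⟨ε, hε⟩ := exists_zero_lt (α := R)
  exact fun b hb => ⟨ε, hε, hb, fun c hc hne => (hne (hX hc hb)).elim⟩

variable [IsOrderedAddMonoid R]

theorem Loc.union {X Y : Set R} (hX : Loc X) (hY : Loc Y) : Loc (X ∪ Y) := by
  obtain ⟨ε, hε, hX⟩ := hX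
  obtain ⟨δ, hδ, hY⟩ := hY
  refine ⟨min ε δ, lt_min hε hδ, fun a => ((hX a).union (hY a)).subset ?_⟩
  rintro x ⟨hx | hx, h1, h2⟩
  · exact Or.inl ⟨hx, h1, h2.trans_le (by gcongr; exact min_le_left _ _)⟩
  · exact Or.inr ⟨hx, h1, h2.trans_le (by gcongr; exact min_le_right _ _)⟩

theorem Loc.neg {X : Set R} (hX : Loc X) : Loc {x | -x ∈ X} := by
  obtain ⟨ε, hε, hX⟩ := hX
  refine ⟨ε, hε, fun a => ?_⟩
  have h := ((hX (-a - ε)).union (Set.finite_singleton (-a))).image (fun x => -x)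
  refine h.subset ?_
  rintro x ⟨hx, h1, h2⟩
  refine ⟨-x, ?_, neg_neg x⟩
  rcases h1.eq_or_lt with rfl | h1
  · exact Or.inr rfl
  · exact Or.inl ⟨hx, by grind, by grind⟩

theorem Loc.translate {X : Set R} (hX : Loc X) (c : R) : Loc {x | x + c ∈ X} := by
  obtain ⟨ε, hε, hX⟩ := hX
  refine ⟨ε, hε, fun a => ((hX (a + c)).image (fun x => x - c)).subset ?_⟩
  rintro x ⟨hx, h1, h2⟩
  exact ⟨x + c, ⟨hx, by grind, by grind⟩, by simp⟩

theorem Loc.ptDisc [Nontrivial R] {X : Set R} (hX : Loc X) : PtDisc X := by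
  obtain ⟨ε, hε, hX⟩ := hX
  intro b hb
  have hfin := (hX (b - ε)).union (hX b)
  obtain ⟨δ, hδ, h⟩ := exists_pos_forall_finset hfin.toFinset
    (Q := fun x δ => x ≠ b → δ ≤ |x - b|)
    (fun x hx => by
      by_cases hxb : x = b
      · exact ⟨ε, hε, fun h => (h hxb).elim⟩
      · exact ⟨|x - b|, abs_pos.2 (sub_ne_zero.2 hxb), fun _ => le_rfl⟩)
    (fun x δ ε _ h h' hx => h.trans (h' hx))
  refine ⟨min δ ε, lt_min hδ hε, hb, fun c hc hne => ?_⟩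
  by_cases hcF : c ∈ hfin.toFinset
  · exact (min_le_left _ _).trans (h c hcF hne)
  · refine (min_le_right _ _).trans ?_
    by_contra! hlt
    rw [abs_lt] at hlt
    refine hcF ?_
    rw [Set.Finite.mem_toFinset]
    rcases le_or_gt b c with hbc | hbc
    · exact Or.inr ⟨hc, hbc, by grind⟩
    · exact Or.inl ⟨hc, by grind, by grind⟩

theorem isDiscrete_iff_ptDisc [Nontrivial R] [TopologicalSpace R] [OrderTopology R] {X : Set R} :
    IsDiscrete X ↔ PtDisc X := by
  rw [isDiscrete_iff_discreteTopology, discreteTopology_subtype_iff']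
  refine forall₂_congr fun b hb => ⟨?_, ?_⟩
  · rintro ⟨U, hU, hUX⟩
    have hbU : b ∈ U := (hUX.ge rfl : b ∈ U ∩ X).1
    obtain ⟨ε, hε, h⟩ := (nhds_basis_abs_sub_lt b).mem_iff.1 (hU.mem_nhds hbU)
    refine ⟨ε, hε, hb, fun c hc hne => le_of_not_gt fun hlt => hne ?_⟩
    exact hUX.le ⟨h hlt, hc⟩
  · rintro ⟨δ, hδ, -, h⟩
    obtain ⟨V, hVs, hV, hbV⟩ := mem_nhds_iff.1 ((nhds_basis_abs_sub_lt b).mem_of_mem hδ)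
    refine ⟨V, hV, Set.eq_singleton_iff_unique_mem.2 ⟨⟨hbV, hb⟩, fun c hc => ?_⟩⟩
    by_contra hne
    exact absurd (hVs hc.1) (not_lt.2 (h c hc.2 hne))

variable {L : FirstOrder.Language.{u, v}} [L.Structure R] {α β : Type} [DefinableOAG L R]
  [Nontrivial R]

/-- The given infinite discrete set provides `N` points with a common isolation radius `ε`; these
play the role of `A` against the translates of `B y`. The translation is an extra parameter, so
neither `N` nor `ε` depends on `y` or `a`. -/
theorem exists_isolated_bound [Tame L R] [Finite α] {B : (α → R) → Set R} (hB : DefFam L B) :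
    ∃ (N : ℕ) (ε : R), 0 < ε ∧ ∀ (y : α → R) (a : R) (t : Finset R),
      (∀ b ∈ t, b ∈ Set.Ico a (a + ε) ∧ ∃ δ, 0 < δ ∧ b ∈ isolatedBy (B y) δ) → t.card < N := by
  obtain ⟨D, hD, hinf, hdisc⟩ := Tame.exists_discrete (L := L) (R := R)
  have hB' : DefFam L fun y : Option α → R => {x | x + y none ∈ B fun i => y (some i)} := by
    apply_rules [hB.mem, DefF.add, DefF.var]
    exact fun i => DefF.var _
  obtain ⟨N, hN⟩ := exists_pattern_bound hD.defFam hB'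
  obtain ⟨S, hSD, hSN⟩ := hinf.exists_subset_card_eq N
  obtain ⟨ε, hε, hS⟩ := exists_pos_forall_finset S (fun b hb => hdisc b (hSD hb))
    fun b δ ε _ h h' => isolatedBy_anti _ h h'
  refine ⟨N, ε, hε, fun y a t ht => not_le.1 fun hNt => ?_⟩
  refine hN (fun o => o.elim a y) ε S (t.map (Equiv.subRight a).toEmbedding) hSN.ge (by simpa)
    hε hS fun b hb => ?_
  obtain ⟨c, hc, rfl⟩ := Finset.mem_map.1 hb
  obtain ⟨⟨h1, h2⟩, δ, hδ, h3, h4⟩ := ht c hc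
  refine ⟨by simpa, by simp; grind, δ, hδ, by simpa, fun d hd hdc => ?_⟩
  have := h4 (d + a) hd (by intro h; apply hdc; simp [← h])
  simp only [Equiv.coe_toEmbedding, Equiv.subRight_apply]
  rwa [show d - (c - a) = d + a - c by abel]

variable (L) in
theorem PtDisc.loc [Tame L R] {X : Set R} (hX : PtDisc X) (hXd : IsDefinable L X) : Loc X := by
  obtain ⟨N, ε, hε, h⟩ := exists_isolated_bound (α := Empty) hXd.defFam
  refine ⟨ε, hε, fun a => ?_⟩
  by_contra hinf
  obtain ⟨t, ht, htN⟩ := Set.Infinite.exists_subset_card_eq hinf N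
  exact (h Empty.elim a t fun b hb => ⟨(ht hb).2, hX b (ht hb).1⟩).ne htN

/-- Only finitely many points of `X` lie close below the supremum, so it is attained. This is the
source of every definable induction below. -/
theorem Loc.exists_isGreatest [Tame L R] {X : Set R} (hX : Loc X) (hXd : IsDefinable L X)
    (hne : X.Nonempty) (hbd : BddAbove X) : ∃ m, IsGreatest X m := by
  obtain ⟨s, hs⟩ := Tame.complete X hXd hne hbd
  obtain ⟨ε, hε, hX⟩ := hX
  have hfin : ((X ∩ Set.Ico (s - ε) (s - ε + ε)) ∪ (X ∩ {s})).Finite :=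
    (hX _).union ((Set.finite_singleton s).subset Set.inter_subset_right)
  obtain ⟨x, hx, hxs⟩ := hs.exists_between (sub_lt_self s hε)
  have hmem : ∀ y ∈ X, s - ε < y → y ∈ ((X ∩ Set.Ico (s - ε) (s - ε + ε)) ∪ (X ∩ {s})) := by
    intro y hy hsy
    rcases (hs.1 hy).eq_or_lt with h | h
    · exact Or.inr ⟨hy, h⟩
    · exact Or.inl ⟨hy, hsy.le, by simpa⟩
  obtain ⟨m, hm, hmax⟩ := Set.exists_max_image _ id hfin ⟨x, hmem x hx hxs.1⟩
  refine ⟨m, hm.elim (fun h => h.1) fun h => h.1, fun y hy => ?_⟩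
  rcases le_or_gt y x with h | h
  · exact h.trans (hmax x (hmem x hx hxs.1))
  · exact hmax y (hmem y hy (hxs.1.trans h))

theorem Loc.exists_isLeast [Tame L R] {X : Set R} (hX : Loc X) (hXd : IsDefinable L X)
    (hne : X.Nonempty) (hbd : BddBelow X) : ∃ m, IsLeast X m := by
  obtain ⟨x, hx⟩ := hne
  obtain ⟨b, hb⟩ := hbd
  obtain ⟨m, hm, hm'⟩ := hX.neg.exists_isGreatest hXd.neg ⟨-x, by simpa⟩
    ⟨-b, fun y hy => le_neg.1 (hb hy)⟩
  exact ⟨-m, hm, fun y hy => neg_le.1 (hm' (by simpa))⟩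

theorem DefP.ptDisc [Finite α] {A : (α → R) → Set R} (hA : DefFam L A)
    {g : α → (β → R) → R} (hg : ∀ i, DefF L (g i)) : DefP L fun v => PtDisc (A fun i => g i v) := by
  have hg' := fun i => (hg i).reindex some
  have hg'' := fun i => (hg' i).reindex some
  refine DefP.all (DefP.imp (hA.mem (DefF.var _) hg') (DefP.ex (DefP.and ?_ ?_)))
  · exact DefP.lt (DefF.const _) (DefF.var _)
  · exact DefP.mem_isolatedBy hA (DefF.var _) hg'' (DefF.var _)

/-- A definable family of sets with a single parameter. -/
def DefFam₁ (L : FirstOrder.Language.{u, v}) [L.Structure R] (G : R → Set R) : Prop :=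
  DefP L fun w : Fin 2 → R => w 1 ∈ G (w 0)

theorem DefFam₁.mem {G : R → Set R} (hG : DefFam₁ L G) {f g : (α → R) → R} (hf : DefF L f)
    (hg : DefF L g) : DefP L fun v => f v ∈ G (g v) := by
  have h := DefP.comp hG (f := ![g, f]) (by intro i; fin_cases i <;> assumption)
  exact h

/-- Each partial union over `x ≤ t` is discrete: a least bad `t` in `B` would add a single `G t` to
a good union. The bound on isolated points is uniform in `t`, and finitely many points of the whole
union already lie in one partial union. -/
theorem Loc.biUnion_of_nonneg [Tame L R] {B : Set R} {G : R → Set R} (hB : Loc B)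
    (hBd : IsDefinable L B) (hB0 : ∀ x ∈ B, 0 ≤ x) (hG : DefFam₁ L G) (hGd : ∀ x ∈ B, PtDisc (G x)) :
    Loc (⋃ x ∈ B, G x) := by
  let U : (Fin 1 → R) → Set R := fun v => {z | ∃ x, x ∈ B ∧ x ≤ v 0 ∧ z ∈ G x}
  have hU : DefFam L U := by
    apply_rules [DefP.ex, DefP.and, hBd.mem, hG.mem, DefP.le, DefF.var]
  have hGl : ∀ x ∈ B, Loc (G x) := fun x hx =>
    (hGd x hx).loc L (isDefinable_of_defP (P := fun z => z ∈ G x)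
      (hG.mem (DefF.var 0) (DefF.const x)) fun _ => Iff.rfl)
  have hUd : ∀ t ∈ B, PtDisc (U fun _ => t) := by
    by_contra! hbad
    let bad : Set R := {t | t ∈ B ∧ ¬ PtDisc (U fun _ => t)}
    have hbadd : IsDefinable L bad :=
      hBd.inter (DefP.not (DefP.ptDisc hU (g := fun _ v => v 0) fun _ => DefF.var 0))
    obtain ⟨t, ⟨htB, ht⟩, hmin⟩ := (hB.mono fun _ h => h.1 : Loc bad).exists_isLeast hbadd hbad
      ⟨0, fun x hx => hB0 x hx.1⟩
    refine ht ?_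
    by_cases hne : (B ∩ {x | x < t}).Nonempty
    · obtain ⟨p, ⟨hpB, hpt⟩, hp⟩ := (hB.mono Set.inter_subset_left :
        Loc (B ∩ {x | x < t})).exists_isGreatest
        (hBd.inter (DefP.lt (DefF.var 0) (DefF.const t))) hne ⟨t, fun x hx => hx.2.le⟩
      have hpU : PtDisc (U fun _ => p) := by
        by_contra hpU
        exact absurd (hmin ⟨hpB, hpU⟩) (not_le.2 hpt)
      have hpl : Loc (U fun _ => p) := hpU.loc L (hU.isDefinable fun _ => p)
      refine ((hpl.union (hGl t htB)).mono ?_).ptDisc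
      rintro z ⟨x, hx, hxt, hz⟩
      rcases hxt.eq_or_lt with h | h
      · exact Or.inr (by rwa [← show x = t from h])
      · exact Or.inl ⟨x, hx, hp ⟨hx, h⟩, hz⟩
    · refine ((hGl t htB).mono ?_).ptDisc
      rintro z ⟨x, hx, hxt, hz⟩
      rcases hxt.eq_or_lt with h | h
      · rwa [← show x = t from h]
      · exact (hne ⟨x, hx, h⟩).elim
  obtain ⟨N, ε, hε, hN⟩ := exists_isolated_bound hU
  refine ⟨ε, hε, fun a => ?_⟩
  by_contra hinf
  obtain ⟨s, hs, hsN⟩ := Set.Infinite.exists_subset_card_eq hinf N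
  have hx : ∀ z ∈ s, ∃ x ∈ B, z ∈ G x := fun z hz => by simpa using (hs hz).1
  choose! x hxB hxG using hx
  have hs0 : s.Nonempty := by
    rw [← Finset.card_pos, hsN]
    exact Nat.zero_le _ |>.trans_lt (hN 0 a ∅ (by simp))
  obtain ⟨m, hm, hmax⟩ := s.exists_max_image x hs0
  refine (hN (fun _ => x m) a s fun z hz => ⟨(hs hz).2, hUd _ (hxB m hm) z ?_⟩).ne hsN
  exact ⟨x z, hxB z hz, hmax z hz, hxG z hz⟩

theorem Loc.biUnion [Tame L R] {B : Set R} {G : R → Set R} (hB : Loc B) (hBd : IsDefinable L B)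
    (hG : DefFam₁ L G) (hGd : ∀ x ∈ B, PtDisc (G x)) : Loc (⋃ x ∈ B, G x) := by
  have h1 := Loc.biUnion_of_nonneg (hB.mono Set.inter_subset_left)
    (hBd.inter (isDefinable_Ici 0)) (fun x hx => hx.2) hG fun x hx => hGd x hx.1
  have h2 := Loc.biUnion_of_nonneg (G := fun x => G (-x))
    (hB.neg.mono (Set.inter_subset_left (t := Set.Ici 0)))
    (hBd.neg.inter (isDefinable_Ici 0)) (fun x hx => hx.2) (hG.mem (DefF.var 1) (DefF.var 0).neg)
    fun x hx => hGd (-x) hx.1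
  refine (h1.union h2).mono fun z hz => ?_
  simp only [Set.mem_iUnion, exists_prop] at hz
  obtain ⟨x, hx, hz⟩ := hz
  rcases le_total 0 x with h | h
  · exact Or.inl (Set.mem_biUnion (x := x) ⟨hx, h⟩ hz)
  · refine Or.inr (Set.mem_biUnion (x := -x) ⟨?_, neg_nonneg.2 h⟩ ?_) <;> simpa

theorem DefP.isLeast {A : (α → R) → R → Prop} {f : (α → R) → R} (hf : DefF L f)
    (hA : DefP L fun w : Option α → R => A (fun i => w (some i)) (w none)) :
    DefP L fun v => IsLeast {x | A v x} (f v) := by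
  refine DefP.and ?_ (DefP.all (DefP.imp hA (DefP.le (hf.reindex some) (DefF.var _))))
  have := (DefP.ex (P := fun v x => x = f v ∧ A v x)
    ((DefF.eq (DefF.var none) (hf.reindex some)).and hA))
  exact this.congr fun v => by simp

theorem Loc.differenceSet [Tame L R] {D : Set R} (hD : Loc D) (hDd : IsDefinable L D) :
    Loc (differenceSet D) := by
  let G : R → Set R := fun a => {d | ∃ b, IsLeast {x | x ∈ D ∧ a < x} b ∧ d = b - a}
  have hG : DefFam₁ L G := by
    refine DefP.ex (DefP.and (DefP.isLeast (A := fun v x => x ∈ D ∧ v (some 0) < x)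
      (DefF.var none) ?_) ?_)
    · exact (hDd.mem (DefF.var none)).and (DefP.lt (DefF.var _) (DefF.var _))
    · exact DefF.eq (DefF.var _) (DefF.sub (DefF.var _) (DefF.var _))
  refine (hD.biUnion hDd hG fun x _ => PtDisc.of_subsingleton ?_).mono ?_
  · rintro _ ⟨b, hb, rfl⟩ _ ⟨c, hc, rfl⟩
    rw [hb.unique hc]
  · rintro d ⟨a, ha, b, hb, rfl⟩
    exact Set.mem_biUnion ha ⟨b, hb, rfl⟩

theorem isDefinable_differenceSet {D : Set R} (hDd : IsDefinable L D) :
    IsDefinable L (differenceSet D) := by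
  refine DefP.ex (DefP.and (hDd.mem (DefF.var none)) (DefP.ex (DefP.and
    (DefP.isLeast (A := fun v x => x ∈ D ∧ v (some none) < x) (DefF.var none) ?_) ?_))) <;>
    apply_rules [DefF.var, DefF.sub, DefP.and, hDd.mem, DefP.lt, DefF.eq]

theorem exists_strictMonoOn_of_infinite {X : Set R} (hX : X.Infinite) (M : ℕ) :
    ∃ f : ℕ → R, (∀ i < M, f i ∈ X) ∧ ∀ i j, i < j → j < M → f i < f j := by
  obtain ⟨s, hs, hsM⟩ := hX.exists_subset_card_eq M
  obtain ⟨x, -⟩ := hX.nonempty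
  let e := s.orderEmbOfFin hsM
  refine ⟨fun i => if h : i < M then e ⟨i, h⟩ else x, fun i hi => ?_, fun i j hij hj => ?_⟩
  · simp only [hi, dif_pos]
    exact hs (s.orderEmbOfFin_mem hsM _)
  · simp only [hj, hij.trans hj, dif_pos]
    exact e.strictMono hij

/-- With many differences, take a middle one `f N`. The starting points of the larger gaps are
isolated by `f N`, while the smaller differences are isolated points of `D'` in `[0, f N)`,
contradicting `exists_pattern_bound`. -/
theorem finite_differenceSet [Tame L R] {D : Set R} (hD : Loc D) (hDd : IsDefinable L D) :
    (differenceSet D).Finite := by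
  by_contra hinf
  let A : (Fin 1 → R) → Set R := fun v => {d | d ∈ D ∧ ∀ x, x ∈ D → d < x → d + v 0 ≤ x}
  have hA : DefFam L A := by
    apply_rules [DefP.all, DefP.imp, DefP.and, hDd.mem, DefP.lt, DefP.le, DefF.add, DefF.var]
  obtain ⟨N, hN⟩ := exists_pattern_bound hA (isDefinable_differenceSet hDd).defFam
  -- The `+ 1` guarantees that `f N` is a genuine difference even when `N = 0`.
  obtain ⟨f, hf, hmono⟩ := exists_strictMonoOn_of_infinite hinf (2 * N + 1)
  have hpos : ∀ d ∈ differenceSet D, 0 < d := by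
    rintro _ ⟨a, -, b, hb, rfl⟩
    exact sub_pos.2 hb.1.2
  have hinj : ∀ i < 2 * N + 1, ∀ j < 2 * N + 1, f i = f j → i = j := by
    intro i hi j hj h
    rcases lt_trichotomy i j with hij | hij | hij
    · exact absurd h (hmono i j hij hj).ne
    · exact hij
    · exact absurd h (hmono j i hij hi).ne'
  choose a haD b hb hab using fun i : {i // i < 2 * N + 1} => hf i.1 i.2
  let a' : ℕ → R := fun i => if h : i < 2 * N + 1 then a ⟨i, h⟩ else 0
  have ha' : ∀ i (h : i < 2 * N + 1), a' i = a ⟨i, h⟩ := fun i h => dif_pos h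
  refine hN (fun _ => f N) (f N) ((Finset.Ico N (2 * N)).image a') ((Finset.range N).image f)
    ?_ ?_ (hpos _ (hf N (by omega))) ?_ ?_
  · rw [Finset.card_image_of_injOn, Nat.card_Ico]
    · omega
    · intro i hi j hj hij
      simp only [Finset.coe_Ico, Set.mem_Ico] at hi hj
      rw [ha' i (by omega), ha' j (by omega)] at hij
      refine hinj i (by omega) j (by omega) ?_
      have h1 := hab ⟨i, by omega⟩
      have h2 := hab ⟨j, by omega⟩
      have h3 := hb ⟨i, by omega⟩
      rw [hij] at h1 h3
      rw [h1, h2, h3.unique (hb _)]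
  · rw [Finset.card_image_of_injOn, Finset.card_range]
    intro i hi j hj hij
    simp only [Finset.coe_range, Set.mem_Iio] at hi hj
    exact hinj i (by omega) j (by omega) hij
  · intro x hx
    obtain ⟨i, hi, rfl⟩ := Finset.mem_image.1 hx
    simp only [Finset.mem_Ico] at hi
    rw [ha' i (by omega)]
    have hgap : ∀ x ∈ D, a ⟨i, by omega⟩ < x → a ⟨i, by omega⟩ + f N ≤ x := by
      intro x hx hlt
      have h1 := (hb ⟨i, by omega⟩).2 ⟨hx, hlt⟩
      have h2 := hab ⟨i, by omega⟩
      have h3 : f N ≤ f i := by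
        rcases hi.1.eq_or_lt with h | h
        · rw [h]
        · exact (hmono N i h (by omega)).le
      simp only at h2
      grind
    refine ⟨⟨haD _, hgap⟩, fun x hx hne => ?_⟩
    rcases lt_or_gt_of_ne hne with h | h
    · have := hx.2 _ (haD ⟨i, by omega⟩) h
      rw [abs_of_neg (sub_neg.2 h)]
      grind
    · have := hgap x hx.1 h
      rw [abs_of_pos (sub_pos.2 h)]
      grind
  · intro x hx
    obtain ⟨i, hi, rfl⟩ := Finset.mem_image.1 hx
    simp only [Finset.mem_range] at hi
    exact ⟨(hpos _ (hf i (by omega))).le, hmono i N hi (by omega),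
      (hD.differenceSet hDd).ptDisc _ (hf i (by omega))⟩

end Discrete

end PseudoArith

namespace PseudoArith

set_option linter.unusedSectionVars false

open FirstOrder

/-! ### The successor function of a discrete set -/

section Successor

variable {R : Type w} [AddCommGroup R] [LinearOrder R] [IsOrderedAddMonoid R] [Nontrivial R]

open Classical in
/-- The least element of `D` above `a`, or `a` itself if there is none. -/
noncomputable def next (D : Set R) (a : R) : R :=
  if h : ∃ b, IsLeast {x | x ∈ D ∧ a < x} b then h.choose else a

variable {L : FirstOrder.Language.{u, v}} [L.Structure R] {α β : Type} [DefinableOAG L R]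
  {D : Set R} {a b : R}

theorem isLeast_next (h : ∃ b, IsLeast {x | x ∈ D ∧ a < x} b) :
    IsLeast {x | x ∈ D ∧ a < x} (next D a) := by
  rw [next, dif_pos h]
  exact h.choose_spec

theorem next_of_not (h : ¬ ∃ b, IsLeast {x | x ∈ D ∧ a < x} b) : next D a = a := dif_neg h

theorem le_next : a ≤ next D a := by
  by_cases h : ∃ b, IsLeast {x | x ∈ D ∧ a < x} b
  · exact (isLeast_next h).1.2.le
  · exact (next_of_not h).ge

theorem next_mem (ha : a ∈ D) : next D a ∈ D := by
  by_cases h : ∃ b, IsLeast {x | x ∈ D ∧ a < x} b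
  · exact (isLeast_next h).1.1
  · rwa [next_of_not h]

theorem next_le (h : a < next D a) (hb : b ∈ D) (hab : a < b) : next D a ≤ b := by
  by_cases h' : ∃ b, IsLeast {x | x ∈ D ∧ a < x} b
  · exact (isLeast_next h').2 ⟨hb, hab⟩
  · exact absurd (next_of_not h') h.ne'

theorem next_injOn {a b : R} (ha : a ∈ D) (hb : b ∈ D) (ha' : a < next D a) (hb' : b < next D b)
    (h : next D a = next D b) : a = b := by
  rcases lt_trichotomy a b with hab | hab | hab
  · exact absurd (next_le ha' hb hab) (not_le.2 (h ▸ hb'))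
  · exact hab
  · exact absurd (next_le hb' ha hab) (not_le.2 (h ▸ ha'))

theorem iterate_next_mem (ha : a ∈ D) (n : ℕ) : (next D)^[n] a ∈ D := by
  induction n with
  | zero => exact ha
  | succ n ih => rw [Function.iterate_succ_apply']; exact next_mem ih

theorem iterate_next_mono (a : R) : Monotone fun n => (next D)^[n] a :=
  monotone_nat_of_le_succ fun n => by
    simp only [Function.iterate_succ_apply']; exact le_next

theorem iterate_next_lt {m n : ℕ} (h : (next D)^[n] a < (next D)^[n + 1] a) (hmn : m ≤ n) :
    (next D)^[m] a < (next D)^[m + 1] a := by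
  by_contra hm
  have hfix : next D ((next D)^[m] a) = (next D)^[m] a := by
    rw [← Function.iterate_succ_apply' (next D)]
    exact le_antisymm (not_lt.1 hm) (iterate_next_mono a (Nat.le_succ m))
  obtain ⟨k, rfl⟩ := Nat.exists_eq_add_of_le hmn
  have key : ∀ j, (next D)^[m + j] a = (next D)^[m] a := by
    intro j
    rw [add_comm, Function.iterate_add_apply]
    exact Function.iterate_fixed hfix j
  rw [add_assoc, key, key] at h
  exact lt_irrefl _ h

theorem iterate_next_strictMono {n : ℕ} (h : (next D)^[n] a < (next D)^[n + 1] a) {i j : ℕ}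
    (hij : i < j) (hj : j ≤ n + 1) : (next D)^[i] a < (next D)^[j] a :=
  (iterate_next_lt h (by omega)).trans_le (iterate_next_mono a hij)

/-- The points of `D` with at most `n` points of `D` above them. -/
def lastPoints (D : Set R) (n : ℕ) : Set R :=
  {a | a ∈ D ∧ ¬ (next D)^[n] a < (next D)^[n + 1] a}

section

variable [Tame L R] (hD : Loc D) (hDd : IsDefinable L D)
include hD hDd

theorem exists_isLeast_gt (hb : b ∈ D) (hab : a < b) : ∃ b, IsLeast {x | x ∈ D ∧ a < x} b :=
  (hD.mono fun _ h => h.1 : Loc {x | x ∈ D ∧ a < x}).exists_isLeast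
    (hDd.inter (DefP.lt (DefF.const a) (DefF.var 0))) ⟨b, hb, hab⟩ ⟨a, fun _ hx => hx.2.le⟩

theorem lt_next (hb : b ∈ D) (hab : a < b) : a < next D a :=
  (isLeast_next (exists_isLeast_gt hD hDd hb hab)).1.2

theorem exists_iterate_eq_or_lt {x y : R} (hy : y ∈ D) (hxy : x ≤ y) (n : ℕ) :
    (∃ i ≤ n, y = (next D)^[i] x) ∨ (next D)^[n] x < y := by
  induction n with
  | zero =>
    rcases hxy.eq_or_lt with h | h
    · exact Or.inl ⟨0, le_rfl, h.symm⟩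
    · exact Or.inr h
  | succ n ih =>
    rcases ih with ⟨i, hi, h⟩ | h
    · exact Or.inl ⟨i, by omega, h⟩
    · have := next_le (lt_next hD hDd hy h) hy h
      rw [← Function.iterate_succ_apply' (next D)] at this
      rcases this.eq_or_lt with h' | h'
      · exact Or.inl ⟨n + 1, le_rfl, h'.symm⟩
      · exact Or.inr h'

/-- `next D` is injective on the points it moves, so each step back adds only finitely many points.
-/
theorem finite_lastPoints (n : ℕ) : (lastPoints D n).Finite := by
  have h0 : (lastPoints D 0).Subsingleton := by
    rintro a ⟨ha, ha'⟩ b ⟨hb, hb'⟩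
    by_contra hne
    rcases lt_or_gt_of_ne hne with h | h
    · exact ha' (lt_next hD hDd hb h)
    · exact hb' (lt_next hD hDd ha h)
  induction n with
  | zero => exact h0.finite
  | succ n ih =>
    have h1 : {a | a ∈ D ∧ a < next D a ∧ next D a ∈ lastPoints D n}.Finite :=
      Set.Finite.of_finite_image (f := next D) (ih.subset (by rintro _ ⟨a, ha, rfl⟩; exact ha.2.2))
        fun a ha b hb h => next_injOn ha.1 hb.1 ha.2.1 hb.2.1 h
    refine (h0.finite.union h1).subset ?_
    rintro a ⟨ha, ha'⟩
    by_cases h : a < next D a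
    · exact Or.inr ⟨ha, h, next_mem ha, ha'⟩
    · exact Or.inl ⟨ha, h⟩

/-- Controls the points that jump over an endpoint `p` within `n` steps; these are exceptions to the
covering by periodic pieces. -/
theorem finite_le_lt_iterate (p : R) (n : ℕ) :
    {x | x ∈ D ∧ x ≤ p ∧ p < (next D)^[n] x}.Finite := by
  induction n with
  | zero =>
    refine Set.finite_empty.subset ?_
    rintro x ⟨-, h1, h2⟩
    exact (h1.trans_lt h2).false
  | succ n ih =>
    have h0 : {x | x ∈ D ∧ x ≤ p ∧ p < next D x}.Subsingleton := by
      rintro a ⟨ha, h1, h2⟩ b ⟨hb, h3, h4⟩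
      by_contra hne
      rcases lt_or_gt_of_ne hne with h | h
      · exact absurd (next_le (h1.trans_lt h2) hb h) (not_le.2 (h3.trans_lt h2))
      · exact absurd (next_le (h3.trans_lt h4) ha h) (not_le.2 (h1.trans_lt h4))
    have h1 : {a | a ∈ D ∧ a < next D a ∧ next D a ∈
        {x | x ∈ D ∧ x ≤ p ∧ p < (next D)^[n] x}}.Finite :=
      Set.Finite.of_finite_image (f := next D) (ih.subset (by rintro _ ⟨a, ha, rfl⟩; exact ha.2.2))
        fun a ha b hb h => next_injOn ha.1 hb.1 ha.2.1 hb.2.1 h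
    refine (h0.finite.union h1).subset ?_
    rintro x ⟨hx, hxp, hp⟩
    rcases lt_or_ge p (next D x) with h | h
    · exact Or.inl ⟨hx, hxp, h⟩
    · refine Or.inr ⟨hx, ?_, next_mem hx, h, hp⟩
      refine lt_of_le_of_ne le_next fun heq => ?_
      rw [Function.iterate_fixed heq.symm] at hp
      exact (hxp.trans_lt hp).false

theorem finite_iterate_sub (n : ℕ) : ((fun x => (next D)^[n] x - x) '' D).Finite := by
  induction n with
  | zero => exact (Set.finite_singleton 0).subset (by rintro _ ⟨x, -, rfl⟩; simp)
  | succ n ih =>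
    refine (Set.Finite.image2 (· + ·) ih
      ((finite_differenceSet hD hDd).insert 0)).subset ?_
    rintro _ ⟨x, hx, rfl⟩
    refine ⟨_, ⟨x, hx, rfl⟩, next D ((next D)^[n] x) - (next D)^[n] x, ?_, ?_⟩
    · by_cases h : ∃ b, IsLeast {y | y ∈ D ∧ (next D)^[n] x < y} b
      · exact Or.inr ⟨_, iterate_next_mem hx n, _, isLeast_next h, rfl⟩
      · exact Or.inl (by rw [next_of_not h, sub_self])
    · simp only [Function.iterate_succ_apply']
      abel

theorem DefF.next {f : (α → R) → R} (hf : DefF L f) : DefF L fun v => next D (f v) := by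
  refine DefF.of_graph (P := fun v x => IsLeast {y | y ∈ D ∧ f v < y} x ∨
    (¬ ∃ b, IsLeast {y | y ∈ D ∧ f v < y} b) ∧ f v = x) ?_ fun v x => ?_
  · have h : DefP L fun w : Option α → R =>
        IsLeast {y | y ∈ D ∧ f (fun i => w (some i)) < y} (w none) := by
      refine DefP.isLeast (A := fun v x => x ∈ D ∧ f (fun i => v (some i)) < x) (DefF.var none) ?_
      exact (hDd.mem (DefF.var none)).and
        (DefP.lt ((hf.reindex some).reindex some) (DefF.var none))
    exact h.or (((DefP.ex (P := fun v x => IsLeast {y | y ∈ D ∧ f v < y} x) h).not.reindex some).and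
      (DefF.eq (hf.reindex some) (DefF.var none)))
  · by_cases h : ∃ b, IsLeast {y | y ∈ D ∧ f v < y} b
    · have h' := isLeast_next h
      exact ⟨fun hx => hx.elim (fun hx => h'.unique hx) fun hx => (hx.1 h).elim,
        fun hx => Or.inl (hx ▸ h')⟩
    · rw [next_of_not h]
      exact ⟨fun hx => hx.elim (fun hx => (h ⟨_, hx⟩).elim) fun hx => hx.2, fun hx => Or.inr ⟨h, hx⟩⟩

theorem DefF.iterate_next {f : (α → R) → R} (hf : DefF L f) (n : ℕ) :
    DefF L fun v => (PseudoArith.next D)^[n] (f v) := by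
  induction n with
  | zero => exact hf
  | succ n ih =>
    simp only [Function.iterate_succ_apply']
    exact DefF.next hD hDd ih

end

end Successor

/-! ### Decomposition into finitely many periodic pieces -/

section Matching

variable {R : Type w} [AddCommGroup R] [LinearOrder R] [IsOrderedAddMonoid R] [Nontrivial R]
  {L : FirstOrder.Language.{u, v}} [L.Structure R] {α β : Type} [DefinableOAG L R] {D : Set R}

/-- The points where `D` and its translate by `-t` disagree. -/
def mismatch (D : Set R) (t : R) : Set R := {x | ¬ (x ∈ D ↔ x + t ∈ D)}

/-- The points of `X` followed by a gap of length at least `l` in `X`. -/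
def gapPoints (X : Set R) (l : R) : Set R := {x | x ∈ X ∧ ∀ y, y ∈ X → x < y → x + l ≤ y}

theorem gapPoints_subset_isolatedBy (X : Set R) (l : R) :
    gapPoints X l ⊆ isolatedBy (gapPoints X l) l := by
  refine fun x hx => ⟨hx, fun y hy hne => ?_⟩
  rcases lt_or_gt_of_ne hne with h | h
  · have := hy.2 x hx.1 h
    rw [abs_of_neg (sub_neg.2 h)]
    grind
  · have := hx.2 y hy.1 h
    rw [abs_of_pos (sub_pos.2 h)]
    grind

theorem Loc.mismatch (hD : Loc D) (t : R) : Loc (mismatch D t) := by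
  refine (hD.union (hD.translate t)).mono fun x hx => ?_
  by_contra h
  simp only [Set.mem_union, Set.mem_ofPred_eq, not_or] at h
  exact hx (iff_of_false h.1 h.2)

theorem IsDefinable.mismatch_mem (hDd : IsDefinable L D) {f g : (α → R) → R} (hf : DefF L f)
    (hg : DefF L g) : DefP L fun v => f v ∈ mismatch D (g v) :=
  ((hDd.mem hf).iff (hDd.mem (hf.add hg))).not

variable [Tame L R] (hD : Loc D) (hDd : IsDefinable L D)
include hD hDd

/-- Gap points are isolated by `l`, so they cannot be numerous once some window of length `l` holds
`N` points of `D`. Since `t` is a parameter of the family, one `N` serves all shifts. -/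
theorem exists_gapPoints_bound : ∃ N : ℕ, ∀ (t l a : R) (s : Finset R), 0 < l → N ≤ s.card →
    (∀ x ∈ s, x ∈ D ∧ x ∈ Set.Ico a (a + l)) → (gapPoints (mismatch D t) l).Finite := by
  let A : (Fin 3 → R) → Set R := fun v => gapPoints (mismatch D (v 0)) (v 1)
  have hA : DefFam L A := by
    refine (hDd.mismatch_mem (DefF.var _) (DefF.var _)).and (DefP.all (DefP.imp ?_ (DefP.imp ?_ ?_)))
    · exact hDd.mismatch_mem (DefF.var _) (DefF.var _)
    · exact DefP.lt (DefF.var _) (DefF.var _)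
    · exact DefP.le (DefF.add (DefF.var _) (DefF.var _)) (DefF.var _)
  let B : (Fin 3 → R) → Set R := fun v => {z | z + v 2 ∈ D}
  have hB : DefFam L B := hDd.mem (DefF.add (DefF.var _) (DefF.var _))
  obtain ⟨N, hN⟩ := exists_pattern_bound hA hB
  refine ⟨N, fun t l a s hl hs hsD => ?_⟩
  by_contra hinf
  obtain ⟨T, hT, hTN⟩ := Set.Infinite.exists_subset_card_eq hinf N
  refine hN ![t, l, a] l T (s.map (Equiv.subRight a).toEmbedding) hTN.ge (by simpa) hl
    (fun x hx => gapPoints_subset_isolatedBy _ _ (hT hx)) fun b hb => ?_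
  obtain ⟨c, hc, rfl⟩ := Finset.mem_map.1 hb
  obtain ⟨h1, h2, h3⟩ := hsD c hc
  refine ⟨by simpa, by simp; grind, (hD.translate a).ptDisc _ (by simpa)⟩

theorem exists_window (hinf : D.Infinite) : ∃ (N : ℕ) (l : R), 0 < l ∧
    (∀ t, (gapPoints (mismatch D t) l).Finite) ∧
    ∀ x ∈ D, ∀ y ∈ D, x ≤ y → y ≤ x + l → ∃ i ≤ N, y = (next D)^[i] x := by
  obtain ⟨N, hN⟩ := exists_gapPoints_bound hD hDd
  have hfin : ((fun x => (next D)^[N + 1] x - x) '' (D \ lastPoints D (N + 1))).Finite :=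
    (finite_iterate_sub hD hDd (N + 1)).subset (Set.image_mono Set.sdiff_subset)
  have hne : (D \ lastPoints D (N + 1)).Nonempty :=
    (hinf.sdiff (finite_lastPoints hD hDd (N + 1))).nonempty
  -- The length `l` is the least span of `N + 1` steps: the window at `a` is full enough to bound
  -- gap points, yet no window of length `l` starting in `D` reaches beyond `N + 1` steps.
  obtain ⟨_, ⟨a, ⟨haD, ha⟩, rfl⟩, hmin⟩ := Set.exists_min_image _ id hfin (hne.image _)
  have ha' : (next D)^[N + 1] a < (next D)^[N + 1 + 1] a := by
    by_contra h
    exact ha ⟨haD, h⟩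
  have hl : 0 < (next D)^[N + 1] a - a :=
    sub_pos.2 (iterate_next_strictMono ha' (i := 0) (by omega) (by omega))
  refine ⟨N + 1, _, hl, fun t => ?_, fun x hx y hy hxy hyl => ?_⟩
  · refine hN t _ a ((Finset.range (N + 1)).image fun i => (next D)^[i] a) hl ?_ ?_
    · rw [Finset.card_image_of_injOn, Finset.card_range]
      · omega
      · intro i hi j hj hij
        simp only [Finset.coe_range, Set.mem_Iio] at hi hj
        rcases lt_trichotomy i j with h | h | h
        · exact absurd hij (iterate_next_strictMono ha' h (by omega)).ne
        · exact h
        · exact absurd hij (iterate_next_strictMono ha' h (by omega)).ne'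
    · intro x hx
      obtain ⟨i, hi, rfl⟩ := Finset.mem_image.1 hx
      simp only [Finset.mem_range] at hi
      refine ⟨iterate_next_mem haD i, iterate_next_mono a (Nat.zero_le i), ?_⟩
      simpa using iterate_next_strictMono ha' hi (by omega)
  · rcases exists_iterate_eq_or_lt hD hDd hy hxy (N + 1) with h | h
    · exact h
    · have hlt := lt_next hD hDd hy h
      rw [← Function.iterate_succ_apply' (next D)] at hlt
      have := hmin _ ⟨x, ⟨hx, fun h => h.2 hlt⟩, rfl⟩
      simp only [id] at this
      grind

theorem exists_shifts (hinf : D.Infinite) : ∃ (C : ℕ) (l : R), 0 < l ∧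
    (∀ t, (gapPoints (mismatch D t) l).Finite) ∧
    ∀ x ∈ D, x ∉ lastPoints D C → ∃ i ≤ C, ∃ k, 0 < k ∧ k ≤ C ∧
      (next D)^[i] x < (next D)^[k] ((next D)^[i] x) ∧
      ∀ z ∈ mismatch D ((next D)^[k] ((next D)^[i] x) - (next D)^[i] x),
        z ∉ Set.Icc ((next D)^[i] x) ((next D)^[i] x + l) := by
  obtain ⟨N, l, hl, hgap, hwin⟩ := exists_window hD hDd hinf
  let pat : R → Set R := fun x => {z | z ∈ Set.Icc 0 l ∧ z + x ∈ D}
  let F : Set R := ⋃ i ∈ Set.Iic N, (fun x => (next D)^[i] x - x) '' D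
  have hF : F.Finite := (Set.finite_Iic N).biUnion fun i _ => finite_iterate_sub hD hDd i
  have hpat : ∀ x ∈ D, pat x ∈ hF.finite_subsets.toFinset := by
    intro x hx
    rw [Set.Finite.mem_toFinset]
    rintro z ⟨⟨h1, h2⟩, hz⟩
    obtain ⟨i, hi, h⟩ := hwin x hx _ hz (by simpa) (by rw [add_comm]; gcongr)
    exact Set.mem_biUnion (Set.mem_Iic.2 hi) ⟨x, hx, by simp [← h]⟩
  refine ⟨hF.finite_subsets.toFinset.card, l, hl, hgap, fun x hx hxl => ?_⟩
  set C := hF.finite_subsets.toFinset.card with hC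
  have hx' : (next D)^[C] x < (next D)^[C + 1] x := by
    by_contra h
    exact hxl ⟨hx, h⟩
  -- Pigeonhole: `C + 1` consecutive points and at most `C` window patterns, so two windows agree
  -- and their distance is the desired shift.
  obtain ⟨i, hi, j, hj, hij, h⟩ := Finset.exists_ne_map_eq_of_card_lt_of_maps_to
    (s := Finset.range (C + 1)) (t := hF.finite_subsets.toFinset)
    (f := fun i => pat ((next D)^[i] x)) (by simp [hC])
    (fun i _ => hpat _ (iterate_next_mem hx i))
  simp only [Finset.mem_range] at hi hj
  wlog hlt : i < j generalizing i j
  · exact this j i hij.symm h.symm hj hi (by omega)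
  have hji : (next D)^[j - i] ((next D)^[i] x) = (next D)^[j] x := by
    rw [← Function.iterate_add_apply]
    congr 1
    omega
  refine ⟨i, by omega, j - i, by omega, by omega, ?_, fun z hz hzI => hz ?_⟩
  · rw [hji]
    exact iterate_next_strictMono hx' hlt (by omega)
  · rw [hji]
    have := Set.ext_iff.1 h (z - (next D)^[i] x)
    have hz' : z - (next D)^[i] x ∈ Set.Icc 0 l := ⟨by grind, by grind⟩
    simp only [pat, Set.mem_ofPred_eq, hz', true_and, sub_add_cancel] at this
    rw [this, sub_add_eq_add_sub, add_sub_assoc]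

/-- `J` is an interval on which `D` is invariant under a translation that moves some point of
`D ∩ J` by finitely many steps in `D`. -/
structure IsPeriodicPiece (L : FirstOrder.Language.{u, v}) [L.Structure R] (D J : Set R) (t : R)
    (k : ℕ) : Prop where
  definable : IsDefinable L J
  ordConnected : J.OrdConnected
  shift_pos : 0 < t
  exists_shift : ∃ y ∈ D, y ∈ J ∧ (next D)^[k] y = y + t
  invariant : ∀ z ∈ J, z ∈ D ↔ z + t ∈ D

theorem exists_periodicPieces (hinf : D.Infinite) :
    ∃ 𝒥 : Set (Set R), 𝒥.Finite ∧ (∀ J ∈ 𝒥, ∃ t k, IsPeriodicPiece L D J t k) ∧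
      (D \ ⋃ J ∈ 𝒥, J).Finite := by
  obtain ⟨C, l, hl, hgap, hsh⟩ := exists_shifts hD hDd hinf
  let T : Set R := ⋃ k ∈ Set.Iic C, (fun x => (next D)^[k] x - x) '' D
  have hT : T.Finite := (Set.finite_Iic C).biUnion fun i _ => finite_iterate_sub hD hDd i
  let P : Set R := ⋃ t ∈ T, gapPoints (mismatch D t) l
  have hP : P.Finite := hT.biUnion fun t _ => hgap t
  -- The stretch after `p` up to the first mismatch for the shift `t`; `⊥` stands for a piece
  -- unbounded below.
  let J : R → WithBot R → Set R := fun t p =>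
    {z | p < (z : WithBot R) ∧ ∀ x, x ∈ mismatch D t → p < (x : WithBot R) → z < x}
  let 𝒥 : Set (Set R) := (Set.image2 J T (insert ⊥ ((↑) '' P))) ∩
    {J | ∃ t k, IsPeriodicPiece L D J t k}
  refine ⟨𝒥, ((hT.image2 _ ((hP.image _).insert _)).inter_of_left _), fun J hJ => hJ.2, ?_⟩
  refine ((finite_lastPoints hD hDd C).union
    (hP.biUnion fun p _ => finite_le_lt_iterate hD hDd p C)).subset ?_
  rintro x ⟨hx, hxJ⟩
  by_cases hxl : x ∈ lastPoints D C
  · exact Or.inl hxl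
  refine Or.inr ?_
  obtain ⟨i, hi, k, -, hkC, hlt, hmis⟩ := hsh x hx hxl
  set y := (next D)^[i] x with hy
  have hyD : y ∈ D := iterate_next_mem hx i
  set t := (next D)^[k] y - y with ht
  have htT : t ∈ T := Set.mem_biUnion (Set.mem_Iic.2 hkC) ⟨y, hyD, rfl⟩
  have hpiece : ∀ p : WithBot R, y ∈ J t p → IsPeriodicPiece L D (J t p) t k := by
    intro p hyJ
    refine ⟨?_, ⟨?_⟩, sub_pos.2 hlt, ⟨y, hyD, hyJ, by rw [ht]; abel⟩, ?_⟩
    · induction p with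
      | bot =>
        refine isDefinable_of_defP (P := fun z => ∀ x, x ∈ mismatch D t → z < x) ?_ ?_
        · exact DefP.all ((hDd.mismatch_mem (DefF.var _) (DefF.const _)).imp
            (DefP.lt (DefF.var _) (DefF.var _)))
        · simp [J]
      | coe p =>
        refine isDefinable_of_defP
          (P := fun z => p < z ∧ ∀ x, x ∈ mismatch D t → p < x → z < x) ?_ ?_
        · exact (DefP.lt (DefF.const _) (DefF.var _)).and
            (DefP.all ((hDd.mismatch_mem (DefF.var _) (DefF.const _)).imp
              ((DefP.lt (DefF.const _) (DefF.var _)).imp (DefP.lt (DefF.var _) (DefF.var _)))))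
        · simp [J]
    · rintro a ⟨ha, -⟩ b ⟨-, hb⟩ c ⟨hac, hcb⟩
      exact ⟨ha.trans_le (by exact_mod_cast hac), fun x hx hpx => hcb.trans_lt (hb x hx hpx)⟩
    · rintro z ⟨hpz, hz⟩
      by_contra h
      exact (hz z h hpz).false
  have hlt_of : ∀ z ∈ mismatch D t, y ≤ z → y + l < z := by
    intro z hz hyz
    by_contra h
    exact hmis z hz ⟨hyz, not_lt.1 h⟩
  by_cases hne : (mismatch D t ∩ {z | z < y}).Nonempty
  · obtain ⟨p, ⟨hpm, hpy⟩, hp⟩ := ((hD.mismatch t).mono Set.inter_subset_left :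
      Loc (mismatch D t ∩ {z | z < y})).exists_isGreatest
      (IsDefinable.inter (hDd.mismatch_mem (DefF.var 0) (DefF.const t))
        (DefP.lt (DefF.var 0) (DefF.const y))) hne ⟨y, fun _ h => h.2.le⟩
    have hpy' : p < y := hpy
    have hge : ∀ z ∈ mismatch D t, p < z → y ≤ z := by
      intro z hz hpz
      by_contra h
      exact absurd (hp ⟨hz, not_le.1 h⟩) (not_le.2 hpz)
    -- The last mismatch before `y` is a gap point, since the next one lies beyond `y + l`. So only
    -- finitely many left endpoints occur.
    have hpP : p ∈ P := by
      refine Set.mem_biUnion htT ⟨hpm, fun z hz hpz => ?_⟩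
      have := hlt_of z hz (hge z hz hpz)
      grind
    have hyJ : y ∈ J t p := ⟨by exact_mod_cast hpy', fun z hz hpz => by
      have := hge z hz (by exact_mod_cast hpz)
      have := hlt_of z hz this
      grind⟩
    have hJ : J t p ∈ 𝒥 := ⟨⟨t, htT, p, Or.inr ⟨p, hpP, rfl⟩, rfl⟩, t, k, hpiece _ hyJ⟩
    -- An uncovered `x` has `x ≤ p`, while at most `C` steps carry it past `p`.
    refine Set.mem_biUnion hpP ⟨hx, ?_, ?_⟩
    · by_contra hpx
      refine hxJ (Set.mem_biUnion hJ ⟨by exact_mod_cast not_le.1 hpx, fun z hz hpz => ?_⟩)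
      exact (iterate_next_mono x (Nat.zero_le i)).trans_lt (hyJ.2 z hz hpz)
    · exact hpy'.trans_le (iterate_next_mono x hi)
  · have hyJ : y ∈ J t ⊥ := ⟨WithBot.bot_lt_coe _, fun z hz _ => by
      by_contra h
      rcases (not_lt.1 h).eq_or_lt with h | h
      · have := hlt_of z hz h.ge
        grind
      · exact hne ⟨z, hz, h⟩⟩
    have hJ : J t ⊥ ∈ 𝒥 := ⟨⟨t, htT, ⊥, Or.inl rfl, rfl⟩, t, k, hpiece _ hyJ⟩
    refine (hxJ (Set.mem_biUnion hJ ⟨WithBot.bot_lt_coe _, fun z hz hpz => ?_⟩)).elim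
    exact (iterate_next_mono x (Nat.zero_le i)).trans_lt (hyJ.2 z hz hpz)

end Matching

end PseudoArith

namespace PseudoArith

set_option linter.unusedSectionVars false

open FirstOrder

/-! ### Recovering a periodic piece from an arithmetic progression -/

section Pieces

variable {R : Type w} [AddCommGroup R] [LinearOrder R] [IsOrderedAddMonoid R] [Nontrivial R]

/-- `P` is an arithmetic progression (possibly nonstandardly long) with first term `0` and common
difference `τ`. -/
structure IsAP (τ : R) (P : Set R) : Prop where
  pos : 0 < τ
  zero_mem : 0 ∈ P
  nonneg : ∀ s ∈ P, 0 ≤ s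
  sub_mem : ∀ s ∈ P, s ≠ 0 → s - τ ∈ P
  add_le : ∀ s ∈ P, ∀ s' ∈ P, s < s' → s + τ ≤ s'

theorem IsAP.loc {τ : R} {P : Set R} (h : IsAP τ P) : Loc P := by
  refine ⟨τ, h.pos, fun a => Set.Subsingleton.finite ?_⟩
  rintro x ⟨hx, h1, h2⟩ y ⟨hy, h3, h4⟩
  by_contra hne
  rcases lt_or_gt_of_ne hne with hxy | hxy
  · have := h.add_le x hx y hy hxy
    grind
  · have := h.add_le y hy x hx hxy
    grind

variable {L : FirstOrder.Language.{u, v}} [L.Structure R] {α β : Type} [DefinableOAG L R] {D : Set R}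

variable (L) in
/-- `Z` is finite, or definable from finitely many infinite definable progressions. -/
def FromAPs (Z : Set R) : Prop :=
  Z.Finite ∨ ∃ 𝒮 : Set (Set R), 𝒮.Finite ∧ 𝒮.Nonempty ∧
    (∀ P ∈ 𝒮, P.Infinite ∧ IsDefinable L P ∧ ∃ τ, IsAP τ P) ∧
    ∀ E, (∀ P ∈ 𝒮, IsDefinableFrom E P) → IsDefinableFrom E Z

theorem isDefinableFrom_of_finite (E : Set R) {Z : Set R} (hZ : Z.Finite) : IsDefinableFrom E Z :=
  let := oagPredStructure E
  isDefinable_of_finite hZ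

theorem IsDefinableFrom.union {E X Y : Set R} (hX : IsDefinableFrom E X)
    (hY : IsDefinableFrom E Y) : IsDefinableFrom E (X ∪ Y) :=
  let := oagPredStructure E
  IsDefinable.union hX hY

theorem FromAPs.union {X Y : Set R} (hX : FromAPs L X) (hY : FromAPs L Y) :
    FromAPs L (X ∪ Y) := by
  rcases hX with hX | ⟨𝒮, h1, h2, h3, h4⟩
  · rcases hY with hY | ⟨𝒯, h5, h6, h7, h8⟩
    · exact Or.inl (hX.union hY)
    · exact Or.inr ⟨𝒯, h5, h6, h7, fun E hE => (isDefinableFrom_of_finite E hX).union (h8 E hE)⟩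
  · rcases hY with hY | ⟨𝒯, h5, h6, h7, h8⟩
    · exact Or.inr ⟨𝒮, h1, h2, h3, fun E hE => (h4 E hE).union (isDefinableFrom_of_finite E hY)⟩
    · exact Or.inr ⟨𝒮 ∪ 𝒯, h1.union h5, h2.inl, fun P hP => hP.elim (h3 P) (h7 P), fun E hE =>
        (h4 E fun P hP => hE P (Or.inl hP)).union (h8 E fun P hP => hE P (Or.inr hP))⟩

theorem FromAPs.biUnion {κ : Type*} {s : Set κ} (hs : s.Finite) {X : κ → Set R}
    (hX : ∀ i ∈ s, FromAPs L (X i)) : FromAPs L (⋃ i ∈ s, X i) := by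
  induction s, hs using Set.Finite.induction_on with
  | empty => exact Or.inl (by simp)
  | insert _ _ ih =>
    rw [Set.biUnion_insert]
    exact (hX _ (Set.mem_insert _ _)).union (ih fun i hi => hX i (Set.mem_insert_of_mem _ hi))

theorem FromAPs.neg {X : Set R} (hX : FromAPs L X) : FromAPs L {x | -x ∈ X} := by
  rcases hX with hX | ⟨𝒮, h1, h2, h3, h4⟩
  · exact Or.inl ((hX.image fun x => -x).subset fun x hx => ⟨-x, hx, neg_neg x⟩)
  · refine Or.inr ⟨𝒮, h1, h2, h3, fun E hE => ?_⟩
    let := oagPredStructure E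
    have := definableOAG_oagPred E
    exact IsDefinable.neg (h4 E hE)

/-- A reflection-invariant form of periodicity of `D` on an interval `J`. -/
structure IsWeakPiece (L : FirstOrder.Language.{u, v}) [L.Structure R] (D J : Set R) (t : R) :
    Prop where
  definable : IsDefinable L J
  ordConnected : J.OrdConnected
  shift_pos : 0 < t
  invariant : ∀ z ∈ J, z + t ∈ J → (z ∈ D ↔ z + t ∈ D)
  finite_Icc : ∀ a ∈ D, a ∈ J → ∀ b ∈ D, b ∈ J → b ≤ a + t → (D ∩ Set.Icc a b).Finite

theorem IsWeakPiece.neg {J : Set R} {t : R} (h : IsWeakPiece L D J t) :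
    IsWeakPiece L {x | -x ∈ D} {x | -x ∈ J} t := by
  refine ⟨h.definable.neg, ⟨?_⟩, h.shift_pos, fun z hz hzt => ?_, fun a ha haJ b hb hbJ hab => ?_⟩
  · rintro a ha b hb c ⟨hac, hcb⟩
    exact h.ordConnected.out hb ha ⟨neg_le_neg hcb, neg_le_neg hac⟩
  · have := h.invariant (-(z + t)) hzt (by simpa)
    simpa using this.symm
  · refine ((h.finite_Icc (-b) hb hbJ (-a) ha haJ (by grind)).image fun x => -x).subset ?_
    rintro x ⟨hx, h1, h2⟩
    exact ⟨-x, ⟨hx, neg_le_neg h2, neg_le_neg h1⟩, neg_neg x⟩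

theorem next_mono {a b : R} (hb : b ∈ D) (hab : a ≤ b) : next D a ≤ next D b := by
  rcases hab.eq_or_lt with rfl | hab
  · rfl
  · rcases le_next (D := D) (a := a) |>.eq_or_lt with h | h
    · exact h.symm.le.trans (hab.le.trans le_next)
    · exact (next_le h hb hab).trans le_next

variable [Tame L R] (hD : Loc D) (hDd : IsDefinable L D)
include hD hDd

theorem IsPeriodicPiece.next_add {J : Set R} {t : R} {k : ℕ} (h : IsPeriodicPiece L D J t k)
    {z : R} (hz : z ∈ D) (hzJ : z ∈ J) (hnJ : next D z ∈ J) (hlt : z < next D z) :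
    next D (z + t) = next D z + t := by
  have hnD := (h.invariant _ hnJ).1 (next_mem hz)
  have hzt : z + t < next D (z + t) := lt_next hD hDd hnD (by gcongr)
  refine (next_le hzt hnD (by gcongr)).eq_or_lt.resolve_right fun hlt' => ?_
  have hmem : next D (z + t) ∈ D := next_mem ((h.invariant z hzJ).1 hz)
  have hJ : next D (z + t) - t ∈ J :=
    h.ordConnected.out hzJ hnJ ⟨by grind, by grind⟩
  have hD' : next D (z + t) - t ∈ D := (h.invariant _ hJ).2 (by simpa)
  have := next_le hlt hD' (by grind)
  grind

/-- Definable induction in both directions from the point where the shift is exactly `k` steps.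
Upwards, `next D` commutes with the shift; downwards, it suffices that `m + t` lies in `D`. This
bounds the number of points of `D` within one shift. -/
theorem IsPeriodicPiece.add_le_iterate {J : Set R} {t : R} {k : ℕ} (h : IsPeriodicPiece L D J t k)
    {z : R} (hz : z ∈ D) (hzJ : z ∈ J) : z + t ≤ (next D)^[k] z := by
  obtain ⟨y, hy, hyJ, hyk⟩ := h.exists_shift
  have hdef : IsDefinable L {z | z ∈ D ∧ z ∈ J ∧ ¬ z + t ≤ (next D)^[k] z} :=
    hDd.inter (h.definable.inter (DefP.not (DefP.le (DefF.add (DefF.var 0) (DefF.const t))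
      (DefF.iterate_next hD hDd (DefF.var 0) k))))
  rcases le_total y z with hyz | hyz
  · by_contra hbad
    obtain ⟨m, ⟨⟨hm, hmJ, hmk⟩, hym⟩, hmin⟩ := (hD.mono fun _ hx => hx.1.1 :
      Loc ({z | z ∈ D ∧ z ∈ J ∧ ¬ z + t ≤ (next D)^[k] z} ∩ Set.Ici y)).exists_isLeast
      (hdef.inter (isDefinable_Ici y)) ⟨z, ⟨hz, hzJ, hbad⟩, hyz⟩ ⟨y, fun _ hx => hx.2⟩
    have hym' : y < m := lt_of_le_of_ne hym (by rintro rfl; exact hmk hyk.ge)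
    obtain ⟨p, ⟨hp, hpm⟩, hpmax⟩ := (hD.mono Set.inter_subset_left :
      Loc (D ∩ {x | x < m})).exists_isGreatest
      (hDd.inter (DefP.lt (DefF.var 0) (DefF.const m))) ⟨y, hy, hym'⟩ ⟨m, fun _ hx => hx.2.le⟩
    have hpm' : p < m := hpm
    have hyp : y ≤ p := hpmax ⟨hy, hym'⟩
    have hpJ : p ∈ J := h.ordConnected.out hyJ hmJ ⟨hyp, hpm'.le⟩
    have hpn : p < next D p := lt_next hD hDd hm hpm'
    have hnext : next D p = m := by
      refine (next_le hpn hm hpm').eq_or_lt.resolve_right fun hlt => ?_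
      exact absurd (hpmax ⟨next_mem hp, hlt⟩) (not_le.2 hpn)
    have hpk : p + t ≤ (next D)^[k] p := by
      by_contra hpk
      exact absurd (hmin ⟨⟨hp, hpJ, hpk⟩, hyp⟩) (not_le.2 hpm')
    have key := h.next_add hD hDd hp hpJ (hnext ▸ hmJ) hpn
    have := next_mono (iterate_next_mem hp k) hpk
    rw [key, hnext, ← Function.iterate_succ_apply' (next D), Function.iterate_succ_apply, hnext] at this
    exact hmk this
  · by_contra hbad
    obtain ⟨m, ⟨⟨hm, hmJ, hmk⟩, hym⟩, hmax⟩ := (hD.mono fun _ hx => hx.1.1 :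
      Loc ({z | z ∈ D ∧ z ∈ J ∧ ¬ z + t ≤ (next D)^[k] z} ∩ Set.Iic y)).exists_isGreatest
      (hdef.inter (isDefinable_Iic y)) ⟨z, ⟨hz, hzJ, hbad⟩, hyz⟩ ⟨y, fun _ hx => hx.2⟩
    have hmy : m < y := lt_of_le_of_ne hym (by rintro rfl; exact hmk hyk.ge)
    have hmn : m < next D m := lt_next hD hDd hy hmy
    have hny : next D m ≤ y := next_le hmn hy hmy
    have hnJ : next D m ∈ J := h.ordConnected.out hmJ hyJ ⟨hmn.le, hny⟩
    have hnk : next D m + t ≤ (next D)^[k] (next D m) := by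
      by_contra hnk
      exact absurd (hmax ⟨⟨next_mem hm, hnJ, hnk⟩, hny⟩) (not_le.2 hmn)
    rw [← Function.iterate_succ_apply, Function.iterate_succ_apply'] at hnk
    have hmt : m + t ∈ D := (h.invariant m hmJ).1 hm
    have := next_le (lt_next hD hDd hmt (not_le.1 hmk)) hmt (not_le.1 hmk)
    grind

theorem IsPeriodicPiece.isWeakPiece {J : Set R} {t : R} {k : ℕ} (h : IsPeriodicPiece L D J t k) :
    IsWeakPiece L D J t := by
  refine ⟨h.definable, h.ordConnected, h.shift_pos, fun z hz _ => h.invariant z hz,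
    fun a ha haJ b hb hbJ hab => ?_⟩
  refine ((Set.finite_Iic k).image fun i => (next D)^[i] a).subset ?_
  rintro x ⟨hx, h1, h2⟩
  rcases exists_iterate_eq_or_lt hD hDd hx h1 k with ⟨i, hi, h⟩ | h'
  · exact ⟨i, hi, h.symm⟩
  · exact absurd ((h2.trans hab).trans (h.add_le_iterate hD hDd ha haJ)) (not_le.2 h')

omit hD hDd in
/-- The periods of `D` on the part of `J` above `x₀`, of at most half its length. -/
def periods (D J : Set R) (x₀ : R) : Set R :=
  {s | 0 ≤ s ∧ x₀ + s + s ∈ J ∧ ∀ z, x₀ ≤ z → z + s ∈ J → (z ∈ D ↔ z + s ∈ D)}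

omit hD in
theorem isDefinable_periods {J : Set R} (hJ : IsDefinable L J) (x₀ : R) :
    IsDefinable L (periods D J x₀) := by
  refine (isDefinable_Ici 0).inter (IsDefinable.inter (hJ.mem ?_) (DefP.all (DefP.imp ?_
    (DefP.imp (hJ.mem ?_) (DefP.iff (hDd.mem ?_) (hDd.mem ?_))))))
  all_goals apply_rules [DefF.var, DefF.const, DefF.add, DefP.le]

/-- Restricting to periods of at most half the length leaves room to compose them, so they form a
progression `P`. Each point of the piece is then reached from a finite set `F` by two periods. -/
theorem IsWeakPiece.fromAPs_inter_Ici {J : Set R} {t : R} (h : IsWeakPiece L D J t) {x₀ : R}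
    (hx₀ : x₀ ∈ D) (hx₀J : x₀ ∈ J) : FromAPs L (D ∩ J ∩ Set.Ici x₀) := by
  have hJ := h.ordConnected
  have ht := h.shift_pos
  have hF1 : (D ∩ J ∩ Set.Ico x₀ (x₀ + t)).Finite := by
    obtain ⟨b, ⟨⟨hbD, hbJ⟩, hb1, hb2⟩, hmax⟩ := (hD.mono fun _ hx => hx.1.1 :
      Loc (D ∩ J ∩ Set.Ico x₀ (x₀ + t))).exists_isGreatest
      ((hDd.inter h.definable).inter ((isDefinable_Ici x₀).inter
        (DefP.lt (DefF.var 0) (DefF.const (x₀ + t)))))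
      ⟨x₀, ⟨hx₀, hx₀J⟩, le_rfl, lt_add_of_pos_right _ ht⟩ ⟨x₀ + t, fun _ hx => hx.2.2.le⟩
    exact (h.finite_Icc x₀ hx₀ hx₀J b hbD hbJ hb2.le).subset
      fun x hx => ⟨hx.1.1, hx.2.1, hmax hx⟩
  have hF2 : (D ∩ J ∩ Set.Ico x₀ (x₀ + t + t)).Finite := by
    refine (hF1.union (hF1.image fun x => x + t)).subset ?_
    rintro x ⟨⟨hxD, hxJ⟩, h1, h2⟩
    rcases lt_or_ge x (x₀ + t) with hx | hx
    · exact Or.inl ⟨⟨hxD, hxJ⟩, h1, hx⟩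
    · have hJ' : x - t ∈ J := hJ.out hx₀J hxJ ⟨by grind, by grind⟩
      refine Or.inr ⟨x - t, ⟨⟨?_, hJ'⟩, by grind, by grind⟩, by simp⟩
      exact (h.invariant _ hJ' (by simpa)).2 (by simpa)
  by_cases htJ : x₀ + t + t ∈ J
  swap
  -- Here the piece is shorter than two shifts, hence finite.
  · refine Or.inl (hF2.subset ?_)
    rintro x ⟨⟨hxD, hxJ⟩, h1⟩
    refine ⟨⟨hxD, hxJ⟩, h1, ?_⟩
    by_contra hx
    exact htJ (hJ.out hx₀J hxJ ⟨by grind, not_lt.1 hx⟩)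
  set P := periods D J x₀ with hP
  have hPd : IsDefinable L P := isDefinable_periods hDd h.definable x₀
  have hmemJ : ∀ s ∈ P, ∀ z, x₀ ≤ z → z ≤ x₀ + s + s → z ∈ J := fun s hs z h1 h2 =>
    hJ.out hx₀J hs.2.1 ⟨h1, h2⟩
  have hPD : ∀ s ∈ P, s + x₀ ∈ D := by
    intro s hs
    have h0 := hs.1
    rw [add_comm, ← hs.2.2 x₀ le_rfl (hmemJ s hs _ (by grind) (by grind))]
    exact hx₀
  have hPl : Loc P := (hD.translate x₀).mono hPD
  have htP : t ∈ P := ⟨ht.le, htJ, fun z hz hzt =>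
    h.invariant z (hJ.out hx₀J hzt ⟨hz, by grind⟩) hzt⟩
  obtain ⟨τ, ⟨hτP, hτ⟩, hτmin⟩ := (hPl.mono Set.inter_subset_left :
    Loc (P ∩ {s | 0 < s})).exists_isLeast (hPd.inter (DefP.lt (DefF.const 0) (DefF.var 0)))
    ⟨t, htP, ht⟩ ⟨0, fun s hs => hs.1.1⟩
  have hτ' : 0 < τ := hτ
  have hsub : ∀ s₁ ∈ P, ∀ s₂ ∈ P, s₁ ≤ s₂ → s₂ - s₁ ∈ P := by
    intro s₁ h₁ s₂ h₂ h12
    have h1 := h₁.1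
    have h2 := h₂.1
    refine ⟨sub_nonneg.2 h12, hmemJ s₂ h₂ _ (by grind) (by grind), fun z hz hzJ => ?_⟩
    -- Away from `x₀`, go back by `s₁` and forward by `s₂`; near `x₀`, go forward first, where
    -- half-length keeps `z + s₂` inside `J`.
    rcases le_or_gt (x₀ + s₁) z with hle | hlt
    · have e1 := h₁.2.2 (z - s₁) (by grind)
        (by rw [sub_add_cancel]; exact hJ.out hx₀J hzJ ⟨hz, by grind⟩)
      have e2 := h₂.2.2 (z - s₁) (by grind) (by rwa [sub_add_eq_add_sub, add_sub_assoc])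
      rw [sub_add_cancel] at e1
      rw [← e1, e2, sub_add_eq_add_sub, add_sub_assoc]
    · have hzJ2 : z + s₂ ∈ J := hmemJ s₂ h₂ _ (by grind) (by grind)
      have e1 := h₂.2.2 z hz hzJ2
      have e2 := h₁.2.2 (z + (s₂ - s₁)) (by grind) (by rwa [add_assoc, sub_add_cancel])
      rw [add_assoc, sub_add_cancel] at e2
      rw [e1, e2]
  have hadd : ∀ s ∈ P, x₀ + (s + τ) + (s + τ) ∈ J → s + τ ∈ P := by
    intro s hs hJs
    have h1 := hs.1
    refine ⟨by grind, hJs, fun z hz hzJ => ?_⟩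
    have e1 := hs.2.2 z hz (hJ.out hx₀J hzJ ⟨by grind, by grind⟩)
    have e2 := hτP.2.2 (z + s) (by grind) (by rwa [add_assoc])
    rw [e1, e2, add_assoc]
  have h0P : (0 : R) ∈ P := ⟨le_rfl, by simpa, by simp⟩
  have hAP : IsAP τ P := by
    refine ⟨hτ, h0P, fun s hs => hs.1, fun s hs hs0 => ?_, fun s hs s' hs' hlt => ?_⟩
    · exact hsub τ hτP s hs (hτmin ⟨hs, lt_of_le_of_ne hs.1 (Ne.symm hs0)⟩)
    · have := hτmin ⟨hsub s hs s' hs' hlt.le, sub_pos.2 hlt⟩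
      grind
  have hτt : τ ≤ t := hτmin ⟨htP, ht⟩
  set F := D ∩ J ∩ Set.Ico x₀ (x₀ + τ + τ) with hF
  have hFfin : F.Finite := hF2.subset fun x hx => ⟨hx.1, hx.2.1, hx.2.2.trans_le (by gcongr)⟩
  have hgreat : ∀ z, x₀ ≤ z → ∃ s ∈ P, x₀ + s ≤ z ∧ ∀ s' ∈ P, x₀ + s' ≤ z → s' ≤ s := by
    intro z hz
    obtain ⟨s, ⟨hs, hsz⟩, hmax⟩ := (hPl.mono Set.inter_subset_left :
      Loc (P ∩ {s | x₀ + s ≤ z})).exists_isGreatest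
      (hPd.inter (DefP.le (DefF.add (DefF.const x₀) (DefF.var 0)) (DefF.const z)))
      ⟨0, h0P, by simpa⟩ ⟨z - x₀, fun s hs => le_sub_iff_add_le'.2 hs.2⟩
    exact ⟨s, hs, hsz, fun s' hs' hsz' => hmax ⟨hs', hsz'⟩⟩
  have hcover : ∀ z ∈ D, z ∈ J → x₀ ≤ z → ∃ f ∈ F, ∃ s ∈ P, ∃ s' ∈ P, z = f + s + s' := by
    intro z hz hzJ hxz
    obtain ⟨s, hs, hsz, hmax⟩ := hgreat z hxz
    have hs0 := hs.1
    have hrJ : z - s ∈ J := hJ.out hx₀J hzJ ⟨by grind, by grind⟩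
    have hrD : z - s ∈ D := (hs.2.2 (z - s) (by grind) (by simpa)).2 (by simpa)
    obtain ⟨s', hs', hsz', hmax'⟩ := hgreat (z - s) (by grind)
    have hs0' := hs'.1
    have hqJ : z - s - s' ∈ J := hJ.out hx₀J hzJ ⟨by grind, by grind⟩
    have hqD : z - s - s' ∈ D := (hs'.2.2 (z - s - s') (by grind) (by simpa)).2 (by simpa)
    refine ⟨z - s - s', ⟨⟨hqD, hqJ⟩, by grind, ?_⟩, s', hs', s, hs, by abel⟩
    -- If `s + τ` is still short enough to be a period, maximality of `s` leaves less than `τ`.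
    -- Otherwise `z` is within `2(s + τ)` of `x₀`, and the second subtraction leaves less than `2τ`.
    by_cases h1 : x₀ + (s + τ) + (s + τ) ∈ J
    · have h2 : ¬ x₀ + (s + τ) ≤ z := fun hle => by
        have := hmax _ (hadd s hs h1) hle
        grind
      grind
    · have h2 : z < x₀ + (s + τ) + (s + τ) := by
        by_contra hle
        exact h1 (hJ.out hx₀J hzJ ⟨by grind, not_lt.1 hle⟩)
      rcases lt_or_ge s' s with h3 | h3
      · have h4 := hAP.add_le s' hs' s hs h3
        have h5 : s' + τ ∈ P := hadd s' hs' (hmemJ s hs _ (by grind) (by grind))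
        have h6 : ¬ x₀ + (s' + τ) ≤ z - s := fun hle => by
          have := hmax' _ h5 hle
          grind
        grind
      · grind
  have hsum : ∀ f ∈ F, ∀ s ∈ P, ∀ s' ∈ P, f + s + s' ∈ J → f + s + s' ∈ D := by
    intro f hf s hs s' hs' hJf
    have h1 := hf.2.1
    have h2 := hs.1
    have h3 := hs'.1
    rw [← hs'.2.2 (f + s) (by grind) hJf,
      ← hs.2.2 f h1 (hJ.out hx₀J hJf ⟨by grind, by grind⟩)]
    exact hf.1.1
  by_cases hPinf : P.Infinite
  swap
  · refine Or.inl (((hFfin.add (Set.not_infinite.1 hPinf)).add (Set.not_infinite.1 hPinf)).subset ?_)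
    rintro z ⟨⟨hz, hzJ⟩, hxz⟩
    obtain ⟨f, hf, s, hs, s', hs', rfl⟩ := hcover z hz hzJ hxz
    exact Set.add_mem_add (Set.add_mem_add hf hs) hs'
  refine Or.inr ⟨{P}, Set.finite_singleton P, Set.singleton_nonempty P, ?_, fun E hE => ?_⟩
  · rintro _ rfl
    exact ⟨hPinf, hPd, τ, hAP⟩
  let := oagPredStructure E
  have := definableOAG_oagPred E
  have hPE : IsDefinable oagPred P := hE P rfl
  have hFE : IsDefinable oagPred F := isDefinable_of_finite hFfin
  have hS : IsDefinable oagPred {z | ∃ f, f ∈ F ∧ ∃ s, s ∈ P ∧ ∃ s', s' ∈ P ∧ z = f + s + s'} := by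
    refine DefP.ex ((hFE.mem (DefF.var none)).and (DefP.ex ((hPE.mem (DefF.var none)).and
      (DefP.ex ((hPE.mem (DefF.var none)).and (DefF.eq (DefF.var _) ?_))))))
    exact ((DefF.var _).add (DefF.var _)).add (DefF.var _)
  -- `J` itself is not available over `E`; it is replaced by an interval ending at the last point of
  -- the piece, or by a ray.
  by_cases hbd : BddAbove (D ∩ J ∩ Set.Ici x₀)
  · obtain ⟨κ, ⟨⟨hκD, hκJ⟩, hκ⟩, hmax⟩ := (hD.mono fun _ hx => hx.1.1 :
      Loc (D ∩ J ∩ Set.Ici x₀)).exists_isGreatest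
      ((hDd.inter h.definable).inter (isDefinable_Ici x₀)) ⟨x₀, ⟨hx₀, hx₀J⟩, le_rfl⟩ hbd
    have heq : D ∩ J ∩ Set.Ici x₀ = Set.Icc x₀ κ ∩
        {z | ∃ f, f ∈ F ∧ ∃ s, s ∈ P ∧ ∃ s', s' ∈ P ∧ z = f + s + s'} := by
      ext z
      constructor
      · intro hz
        exact ⟨⟨hz.2, hmax hz⟩, hcover z hz.1.1 hz.1.2 hz.2⟩
      · rintro ⟨hz, f, hf, s, hs, s', hs', rfl⟩
        have hzJ := hJ.out hx₀J hκJ hz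
        exact ⟨⟨hsum f hf s hs s' hs' hzJ, hzJ⟩, hz.1⟩
    rw [heq]
    exact (isDefinable_Icc x₀ κ).inter hS
  · have hIci : ∀ z, x₀ ≤ z → z ∈ J := by
      intro z hz
      rw [not_bddAbove_iff] at hbd
      obtain ⟨y, hy, hzy⟩ := hbd z
      exact hJ.out hx₀J hy.1.2 ⟨hz, hzy.le⟩
    have heq : D ∩ J ∩ Set.Ici x₀ = Set.Ici x₀ ∩
        {z | ∃ f, f ∈ F ∧ ∃ s, s ∈ P ∧ ∃ s', s' ∈ P ∧ z = f + s + s'} := by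
      ext z
      constructor
      · intro hz
        exact ⟨hz.2, hcover z hz.1.1 hz.1.2 hz.2⟩
      · rintro ⟨hz, f, hf, s, hs, s', hs', rfl⟩
        exact ⟨⟨hsum f hf s hs s' hs' (hIci _ hz), hIci _ hz⟩, hz⟩
    rw [heq]
    exact (isDefinable_Ici x₀).inter hS

/-- The part below `x₀` is the reflection of the one-sided case, which is why weak pieces are
reflection-invariant. -/
theorem IsWeakPiece.fromAPs {J : Set R} {t : R} (h : IsWeakPiece L D J t) :
    FromAPs L (D ∩ J) := by
  rcases (D ∩ J).eq_empty_or_nonempty with he | ⟨x₀, hx₀, hx₀J⟩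
  · exact Or.inl (he ▸ Set.finite_empty)
  · have h1 := h.fromAPs_inter_Ici hD hDd hx₀ hx₀J
    have h2 := (h.neg.fromAPs_inter_Ici hD.neg hDd.neg (x₀ := -x₀) (by simpa) (by simpa)).neg
    convert h1.union h2 using 1
    ext z
    constructor
    · rintro ⟨hz, hzJ⟩
      rcases le_total x₀ z with hle | hle
      · exact Or.inl ⟨⟨hz, hzJ⟩, hle⟩
      · exact Or.inr ⟨⟨by simpa, by simpa⟩, neg_le_neg hle⟩
    · rintro (hz | hz)
      · exact hz.1
      · exact ⟨by simpa using hz.1.1, by simpa using hz.1.2⟩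

theorem fromAPs_of_infinite (hinf : D.Infinite) : FromAPs L D := by
  obtain ⟨𝒥, hfin, hpiece, hrest⟩ := exists_periodicPieces hD hDd hinf
  have h1 : FromAPs L (⋃ J ∈ 𝒥, D ∩ J) := FromAPs.biUnion hfin fun J hJ => by
    obtain ⟨t, k, h⟩ := hpiece J hJ
    exact (h.isWeakPiece hD hDd).fromAPs hD hDd
  have h2 := FromAPs.union (L := L) (Or.inl hrest) h1
  rwa [← Set.inter_iUnion₂, Set.sdiff_union_inter] at h2

end Pieces

end PseudoArith

namespace PseudoArith

set_option linter.unusedSectionVars false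

open FirstOrder

/-! ### Commensurability and nesting of progressions -/

section Progressions

variable {R : Type w} [AddCommGroup R] [LinearOrder R] [IsOrderedAddMonoid R] [Nontrivial R]
  {L : FirstOrder.Language.{u, v}} [L.Structure R] [DefinableOAG L R]
  {τ τ' : R} {P P' : Set R}

theorem IsAP.isolatedBy (h : IsAP τ P) {s : R} (hs : s ∈ P) : s ∈ isolatedBy P τ := by
  refine ⟨hs, fun s' hs' hne => ?_⟩
  rcases lt_or_gt_of_ne hne with hlt | hlt
  · have := h.add_le s' hs' s hs hlt
    rw [abs_of_neg (sub_neg.2 hlt)]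
    grind
  · have := h.add_le s hs s' hs' hlt
    rw [abs_of_pos (sub_pos.2 hlt)]
    grind

theorem IsAP.eq_nsmul_of_le (h : IsAP τ P) (k : ℕ) : ∀ s ∈ P, s ≤ k • τ → ∃ i ≤ k, s = i • τ := by
  induction k with
  | zero =>
    intro s hs hsk
    exact ⟨0, le_rfl, le_antisymm (by simpa using hsk) (by simpa using h.nonneg s hs)⟩
  | succ k ih =>
    intro s hs hsk
    by_cases hs0 : s = 0
    · exact ⟨0, by omega, by simpa⟩
    · obtain ⟨i, hi, his⟩ := ih (s - τ) (h.sub_mem s hs hs0) (by rw [succ_nsmul] at hsk; grind)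
      exact ⟨i + 1, by omega, by rw [succ_nsmul, ← his]; abel⟩

theorem IsAP.add_mem [Tame L R] (h : IsAP τ P) (hP : IsDefinable L P) {s s' : R} (hs : s ∈ P)
    (hs' : s' ∈ P) (hlt : s < s') : s + τ ∈ P := by
  obtain ⟨m, ⟨hm, hsm⟩, hmin⟩ := (h.loc.mono Set.inter_subset_left :
    Loc (P ∩ {x | s < x})).exists_isLeast
    (hP.inter (DefP.lt (DefF.const s) (DefF.var 0))) ⟨s', hs', hlt⟩ ⟨s, fun x hx => hx.2.le⟩
  have hsm' : s < m := hsm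
  have hτ := h.pos
  have h0 := h.nonneg s hs
  have h1 := h.sub_mem m hm (by grind)
  have h2 : m - τ ≤ s := by
    by_contra hcon
    have := hmin ⟨h1, not_le.1 hcon⟩
    grind
  have h3 := h.add_le s hs m hm hsm'
  rwa [show s + τ = m by grind]

theorem IsAP.nsmul_mem [Tame L R] (h : IsAP τ P) (hP : IsDefinable L P) (hinf : P.Infinite)
    (k : ℕ) : k • τ ∈ P := by
  induction k with
  | zero => simpa using h.zero_mem
  | succ k ih =>
    obtain ⟨s, hs, hlt⟩ : ∃ s ∈ P, k • τ < s := by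
      by_contra! hcon
      refine hinf (((Set.finite_Iic k).image fun i => i • τ).subset fun s hs => ?_)
      obtain ⟨i, hi, rfl⟩ := h.eq_nsmul_of_le k s hs (hcon s hs)
      exact ⟨i, hi, rfl⟩
    rw [succ_nsmul]
    exact h.add_mem hP ih hs hlt

theorem IsAP.nsmul_injective (h : IsAP τ P) : Function.Injective fun k : ℕ => k • τ :=
  nsmul_left_strictMono h.pos |>.injective

/-- Otherwise all multiples of `τ` fit below `τ'`, and `P'` with `P` violates
`exists_pattern_bound`. -/
theorem IsAP.exists_lt_nsmul [Tame L R] (h : IsAP τ P) (hP : IsDefinable L P) (hinf : P.Infinite)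
    (h' : IsAP τ' P') (hP' : IsDefinable L P') (hinf' : P'.Infinite) : ∃ k : ℕ, τ' < k • τ := by
  by_contra! hcon
  obtain ⟨N, hN⟩ := exists_pattern_bound (α := Empty) hP'.defFam hP.defFam
  refine hN Empty.elim τ' ((Finset.range N).image fun k => k • τ')
    ((Finset.range N).image fun k => k • τ) ?_ ?_ h'.pos ?_ ?_
  · rw [Finset.card_image_of_injective _ h'.nsmul_injective, Finset.card_range]
  · rw [Finset.card_image_of_injective _ h.nsmul_injective, Finset.card_range]
  · intro a ha
    obtain ⟨k, -, rfl⟩ := Finset.mem_image.1 ha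
    exact h'.isolatedBy (h'.nsmul_mem hP' hinf' k)
  · intro b hb
    obtain ⟨k, -, rfl⟩ := Finset.mem_image.1 hb
    refine ⟨nsmul_nonneg h.pos.le k, ?_, h.loc.ptDisc _ (h.nsmul_mem hP hinf k)⟩
    exact (nsmul_left_strictMono h.pos (Nat.lt_succ_self k)).trans_le (hcon (k + 1))

/-- The definable set of differences `P - P'` is locally finite. If `τ` and `τ'` were
incommensurable, the multiples of `τ'` would have infinitely many residues modulo `τ`, giving
infinitely many points of it in `[0, τ)`, against the `τ`-separated set `P`. -/
theorem IsAP.commensurable [Tame L R] (h : IsAP τ P) (hP : IsDefinable L P) (hinf : P.Infinite)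
    (h' : IsAP τ' P') (hP' : IsDefinable L P') (hinf' : P'.Infinite) :
    ∃ m n : ℕ, 0 < m ∧ 0 < n ∧ m • τ = n • τ' := by
  obtain ⟨k, hk⟩ := h.exists_lt_nsmul hP hinf h' hP' hinf'
  let G : R → Set R := fun y => {z | z + y ∈ P}
  have hG : DefFam₁ L G := hP.mem ((DefF.var _).add (DefF.var _))
  have hB : Loc (⋃ y ∈ P', G y) :=
    h'.loc.biUnion hP' hG fun y _ => (h.loc.translate y).ptDisc
  have hBd : IsDefinable L (⋃ y ∈ P', G y) := by
    refine isDefinable_of_defP (P := fun z => ∃ y, y ∈ P' ∧ z ∈ G y) ?_ (by simp)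
    exact DefP.ex ((hP'.mem (DefF.var _)).and (hG.mem (DefF.var _) (DefF.var _)))
  obtain ⟨N, hN⟩ := exists_pattern_bound (α := Empty) hP.defFam hBd.defFam
  by_contra! hcon
  -- `q` is the ceiling of `l • τ'` over `τ`; it exists by the Archimedean comparison.
  have hq : ∀ l : ℕ, ∃ q : ℕ, l • τ' ≤ q • τ ∧ q • τ < l • τ' + τ := by
    intro l
    have hex : ∃ q : ℕ, l • τ' ≤ q • τ := by
      refine ⟨l * k, ?_⟩
      rw [mul_comm, mul_nsmul]
      exact nsmul_le_nsmul_right hk.le l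
    classical
    refine ⟨Nat.find hex, Nat.find_spec hex, ?_⟩
    rcases hf : Nat.find hex with _ | q
    · rw [zero_nsmul]
      exact add_pos_of_nonneg_of_pos (nsmul_nonneg h'.pos.le l) h.pos
    · have := Nat.find_min hex (m := q) (by omega)
      rw [succ_nsmul]
      gcongr
      exact not_le.1 this
  choose q hq hq' using hq
  refine hN Empty.elim τ ((Finset.range N).image fun k => k • τ)
    ((Finset.range N).image fun l => q l • τ - l • τ') ?_ ?_ h.pos ?_ ?_
  · rw [Finset.card_image_of_injective _ h.nsmul_injective, Finset.card_range]
  · rw [Finset.card_image_of_injective, Finset.card_range]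
    intro l l' hll
    by_contra hne
    wlog hlt : l < l' generalizing l l'
    · exact this hll.symm (Ne.symm hne) (by omega)
    simp only at hll
    have hpos := nsmul_left_strictMono h'.pos hlt
    have hlt' : q l < q l' := by
      refine (nsmul_left_strictMono h.pos).lt_iff_lt.1 ?_
      simp only at hpos ⊢
      grind
    refine hcon (q l' - q l) (l' - l) (by omega) (by omega) ?_
    have e1 : q l' • τ = (q l' - q l) • τ + q l • τ := by
      rw [← add_nsmul, Nat.sub_add_cancel hlt'.le]
    have e2 : l' • τ' = (l' - l) • τ' + l • τ' := by
      rw [← add_nsmul, Nat.sub_add_cancel hlt.le]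
    rw [e1, e2] at hll
    grind
  · intro a ha
    obtain ⟨k, -, rfl⟩ := Finset.mem_image.1 ha
    exact h.isolatedBy (h.nsmul_mem hP hinf k)
  · intro b hb
    obtain ⟨l, -, rfl⟩ := Finset.mem_image.1 hb
    refine ⟨sub_nonneg.2 (hq l), sub_lt_iff_lt_add'.2 (hq' l), hB.ptDisc _ ?_⟩
    refine Set.mem_biUnion (h'.nsmul_mem hP' hinf' l) ?_
    simpa [G] using h.nsmul_mem hP hinf (q l)

theorem exists_common_multiple {κ : Type*} {s : Set κ} (hs : s.Finite) (τ : κ → R) (σ : R)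
    (h : ∀ i ∈ s, ∃ m n : ℕ, 0 < m ∧ 0 < n ∧ m • τ i = n • σ) :
    ∃ M : ℕ, 0 < M ∧ ∀ i ∈ s, ∃ k : ℕ, 0 < k ∧ k • τ i = M • σ := by
  induction s, hs using Set.Finite.induction_on with
  | empty => exact ⟨1, one_pos, by simp⟩
  | insert _ _ ih =>
    obtain ⟨M, hM, hMs⟩ := ih fun i hi => h i (Set.mem_insert_of_mem _ hi)
    obtain ⟨m, n, hm, hn, hmn⟩ := h _ (Set.mem_insert _ _)
    refine ⟨M * n, Nat.mul_pos hM hn, fun i hi => ?_⟩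
    rcases hi with rfl | hi
    · exact ⟨M * m, Nat.mul_pos hM hm, by rw [mul_comm, mul_nsmul, hmn, mul_comm, mul_nsmul]⟩
    · obtain ⟨k, hk, hki⟩ := hMs i hi
      exact ⟨k * n, Nat.mul_pos hk hn, by rw [mul_nsmul, hki, mul_nsmul]⟩

theorem IsAP.image_nsmul (h : IsAP τ P) {n : ℕ} (hn : 0 < n) :
    IsAP (n • τ) ((fun s => n • s) '' P) := by
  refine ⟨nsmul_pos h.pos hn.ne', ⟨0, h.zero_mem, by simp⟩, ?_, ?_, ?_⟩
  · rintro _ ⟨s, hs, rfl⟩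
    exact nsmul_nonneg (h.nonneg s hs) n
  · rintro _ ⟨s, hs, rfl⟩ hs0
    refine ⟨s - τ, h.sub_mem s hs ?_, nsmul_sub _ _ _⟩
    rintro rfl
    exact hs0 (nsmul_zero n)
  · rintro _ ⟨s, hs, rfl⟩ _ ⟨s', hs', rfl⟩ hlt
    simp only at hlt ⊢
    rw [← nsmul_add]
    exact nsmul_le_nsmul_right (h.add_le s hs s' hs' (lt_of_nsmul_lt_nsmul_right n hlt)) n

theorem isDefinable_image_nsmul (hP : IsDefinable L P) (n : ℕ) :
    IsDefinable L ((fun s => n • s) '' P) := by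
  refine isDefinable_of_defP (P := fun z => ∃ s, s ∈ P ∧ n • s = z) ?_ fun _ => Iff.rfl
  exact DefP.ex ((hP.mem (DefF.var _)).and (DefF.eq (DefF.nsmul (DefF.var _) n) (DefF.var _)))

/-- Compare the first place where each progression leaves the other: the one that leaves earlier
would have to continue there, since it has a later term. -/
theorem IsAP.subset_or_subset [Tame L R] (h : IsAP τ P) (hP : IsDefinable L P) (h' : IsAP τ P')
    (hP' : IsDefinable L P') : P ⊆ P' ∨ P' ⊆ P := by
  by_contra! hcon
  have first : ∀ {A B : Set R}, IsAP τ A → IsDefinable L A → IsAP τ B → IsDefinable L B →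
      ¬ A ⊆ B → ∃ s ∈ A, s ∉ B ∧ s - τ ∈ B := by
    intro A B hA hAd hB hBd hAB
    obtain ⟨x, hx, hxB⟩ := Set.not_subset.1 hAB
    obtain ⟨s, ⟨hs, hsB⟩, hmin⟩ := (hA.loc.mono fun _ hx => hx.1 : Loc (A \ B)).exists_isLeast
      (hAd.diff hBd) ⟨x, hx, hxB⟩ ⟨0, fun y hy => hA.nonneg y hy.1⟩
    refine ⟨s, hs, hsB, ?_⟩
    by_contra hsub
    have := hmin ⟨hA.sub_mem s hs (by rintro rfl; exact hsB hB.zero_mem), hsub⟩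
    exact absurd this (not_le.2 (sub_lt_self s hA.pos))
  obtain ⟨s, hs, hsP', hsτ⟩ := first h hP h' hP' hcon.1
  obtain ⟨s', hs', hsP, hsτ'⟩ := first h' hP' h hP hcon.2
  have hτ := h.pos
  rcases le_total s s' with hle | hle
  · have := h'.add_mem hP' hsτ hs' (by grind)
    rw [sub_add_cancel] at this
    exact hsP' this
  · have := h.add_mem hP hsτ' hs (by grind)
    rw [sub_add_cancel] at this
    exact hsP this

theorem IsAP.mem_of_le [Tame L R] (h : IsAP τ P) (hP : IsDefinable L P) (h' : IsAP τ P')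
    (hP' : IsDefinable L P') {s c : R} (hs : s ∈ P') (hc : c ∈ P) (hsc : s ≤ c) : s ∈ P := by
  by_contra hbad
  obtain ⟨m, ⟨⟨hm, hmP⟩, hmc⟩, hmin⟩ := (h'.loc.mono fun _ hx => hx.1.1 :
    Loc ((P' \ P) ∩ Set.Iic c)).exists_isLeast ((hP'.diff hP).inter (isDefinable_Iic c))
    ⟨s, ⟨hs, hbad⟩, hsc⟩ ⟨0, fun x hx => h'.nonneg x hx.1.1⟩
  have hτ := h.pos
  have hmc' : m ≤ c := hmc
  have hmem := h'.sub_mem m hm (by rintro rfl; exact hmP h.zero_mem)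
  have hmP' : m - τ ∈ P := by
    by_contra hcon
    exact absurd (hmin ⟨⟨hmem, hcon⟩, (sub_lt_self m hτ).le.trans hmc'⟩)
      (not_le.2 (sub_lt_self m hτ))
  have := h.add_mem hP hmP' hc (by grind)
  rw [sub_add_cancel] at this
  exact hmP this

theorem IsAP.isDefinableFrom [Tame L R] (h : IsAP τ P) (hP : IsDefinable L P) (h' : IsAP τ P')
    (hP' : IsDefinable L P') (hsub : P ⊆ P') : IsDefinableFrom P' P := by
  let := oagPredStructure P'
  have := definableOAG_oagPred P'
  have hself : IsDefinable oagPred P' := isDefinableFrom_self P'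
  by_cases hbd : BddAbove P
  · obtain ⟨c, hc, hmax⟩ := h.loc.exists_isGreatest hP ⟨0, h.zero_mem⟩ hbd
    have heq : P = P' ∩ Set.Iic c := Set.Subset.antisymm (fun s hs => ⟨hsub hs, hmax hs⟩)
      fun s hs => h.mem_of_le hP h' hP' hs.1 hc hs.2
    have hres : IsDefinable oagPred (P' ∩ Set.Iic c) := hself.inter (isDefinable_Iic c)
    rw [← heq] at hres
    exact hres
  · have heq : P = P' := hsub.antisymm fun s hs => by
      rw [not_bddAbove_iff] at hbd
      obtain ⟨c, hc, hsc⟩ := hbd s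
      exact h.mem_of_le hP h' hP' hs hc hsc.le
    rw [← heq] at hself
    rw [heq]
    exact isDefinableFrom_self P'

theorem IsAP.isPseudoArithmetic [Tame L R] [TopologicalSpace R] [OrderTopology R] (h : IsAP τ P)
    (hP : IsDefinable L P) (hinf : P.Infinite) : IsPseudoArithmetic P := by
  refine ⟨isDiscrete_iff_ptDisc.2 h.loc.ptDisc, τ, Set.Subset.antisymm ?_ ?_⟩
  · rintro _ ⟨a, ha, b, ⟨⟨hb, hab⟩, hmin⟩, rfl⟩
    have h1 := h.add_mem hP ha hb hab
    have h2 := hmin ⟨h1, lt_add_of_pos_right a h.pos⟩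
    have h3 := h.add_le a ha b hb hab
    rw [Set.mem_singleton_iff, le_antisymm h2 h3, add_sub_cancel_left]
  · rw [Set.singleton_subset_iff]
    have h1 : τ ∈ P := by simpa using h.nsmul_mem hP hinf 1
    refine ⟨0, h.zero_mem, τ, ⟨⟨h1, h.pos⟩, fun x hx => ?_⟩, (sub_zero τ).symm⟩
    simpa using h.add_le 0 h.zero_mem x hx.1 hx.2

theorem exists_ap_isDefinableFrom [Tame L R] {𝒮 : Set (Set R)} (hfin : 𝒮.Finite)
    (hne : 𝒮.Nonempty) (h𝒮 : ∀ P ∈ 𝒮, P.Infinite ∧ IsDefinable L P ∧ ∃ τ, IsAP τ P) :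
    ∃ (η : R) (E : Set R), IsAP η E ∧ IsDefinable L E ∧ E.Infinite ∧
      ∀ P ∈ 𝒮, IsDefinableFrom E P := by
  have hinf := fun P hP => (h𝒮 P hP).1
  have hdef := fun P hP => (h𝒮 P hP).2.1
  choose! t hAP using fun P hP => (h𝒮 P hP).2.2
  obtain ⟨P₀, hP₀⟩ := hne
  obtain ⟨M, hM, hmul⟩ := exists_common_multiple hfin t (t P₀) fun P hP =>
    (hAP P hP).commensurable (hdef P hP) (hinf P hP) (hAP P₀ hP₀) (hdef P₀ hP₀) (hinf P₀ hP₀)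
  choose! k hk hkτ using hmul
  -- Scaling by `k P` gives all progressions the same difference. It is injective, so `P` is
  -- recovered from its image.
  let F : Set R → Set R := fun P => (fun s => k P • s) '' P
  have hF : ∀ P ∈ 𝒮, IsAP (M • t P₀) (F P) := fun P hP =>
    hkτ P hP ▸ (hAP P hP).image_nsmul (hk P hP)
  have hFd : ∀ P ∈ 𝒮, IsDefinable L (F P) := fun P hP => isDefinable_image_nsmul (hdef P hP) _
  have hinj : ∀ P ∈ 𝒮, Function.Injective fun s : R => k P • s := fun P hP =>
    nsmul_right_injective (hk P hP).ne'
  obtain ⟨E, hE⟩ := (hfin.image F).exists_maximal ⟨_, P₀, hP₀, rfl⟩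
  obtain ⟨Q, hQ, hQE⟩ := hE.prop
  subst hQE
  refine ⟨_, F Q, hF Q hQ, hFd Q hQ, (hinf Q hQ).image (hinj Q hQ).injOn, fun P hP => ?_⟩
  have hsub : F P ⊆ F Q := by
    rcases (hF P hP).subset_or_subset (hFd P hP) (hF Q hQ) (hFd Q hQ) with h | h
    · exact h
    · exact hE.le_of_ge ⟨P, hP, rfl⟩ h
  have hFP := (hF P hP).isDefinableFrom (hFd P hP) (hF Q hQ) (hFd Q hQ) hsub
  let := oagPredStructure (F Q)
  have := definableOAG_oagPred (F Q)
  exact isDefinable_of_defP (P := fun x => k P • x ∈ F P)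
    (IsDefinable.mem hFP (DefF.nsmul (DefF.var 0) (k P)))
    fun x => ((hinj P hP).mem_set_image).symm

end Progressions

end PseudoArith

theorem mainTheorem4 {L : FirstOrder.Language.{u, v}} {R : Type w}
    [AddCommGroup R] [LinearOrder R] [IsOrderedAddMonoid R]
    [TopologicalSpace R] [OrderTopology R]
    [L.Structure R] (ι : PseudoArith.oag →ᴸ L) [ι.IsExpansionOn R]
    (hdiv : ∀ n : ℕ, 0 < n → ∀ g : R, ∃ h : R, n • h = g)
    (hcomplete : PseudoArith.DefinablyComplete L R)
    (hburden : PseudoArith.HasBurden L R 2)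
    (D : Set R) (hDdef : PseudoArith.IsDefinable L D) (hDinf : D.Infinite)
    (hDdisc : IsDiscrete D) :
    ∃ E : Set R, PseudoArith.IsDefinable L E ∧ PseudoArith.IsPseudoArithmetic E ∧
      PseudoArith.IsDefinableFrom E D := by
  have : Nontrivial R := by
    obtain ⟨a, -, b, -, hab⟩ := hDinf.nontrivial
    exact ⟨a, b, hab⟩
  have : PseudoArith.DefinableOAG L R := PseudoArith.definableOAG_of_expansion ι
  have hD : PseudoArith.PtDisc D := PseudoArith.isDiscrete_iff_ptDisc.1 hDdisc
  have : PseudoArith.Tame L R := by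
    refine ⟨hcomplete, ⟨fun a b hab => ?_⟩, ?_, D, hDdef, hDinf, hD⟩
    -- Halving gives density of the order.
    · obtain ⟨h, hh⟩ := hdiv 2 two_pos (b - a)
      rw [two_nsmul] at hh
      exact ⟨a + h, by grind, by grind⟩
    · have h3 : Order.succ (2 : Cardinal.{0}) = 3 := by
        have := Cardinal.succ_natCast 2
        norm_num at this
        exact this
      have := hburden.1
      rw [h3] at this
      exact this
  rcases PseudoArith.fromAPs_of_infinite (hD.loc L hDdef) hDdef hDinf with
    hfin | ⟨𝒮, hfin, hne, h𝒮, hfrom⟩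
  · exact (hDinf hfin).elim
  · obtain ⟨η, E, hE, hEd, hEinf, hEP⟩ := PseudoArith.exists_ap_isDefinableFrom hfin hne h𝒮
    exact ⟨E, hEd, hE.isPseudoArithmetic hEd hEinf, hfrom E hEP⟩
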